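/- Let $\mathbb{K}\in\{\mathbb{R},\mathbb{C}\}$ and let $\ell,n,m\ge 1$ be integers. *Relative genericity.* A set $\mathbb{V}\subseteq\mathbb{R}^d$ is *algebraic* if it is the set of common zeros of finitely many polynomials in $\mathbb{R}[x_1,\dots,x_d]$. For $S,V\subseteq\mathbb{R}^d$, the set $S$ is *relative generic in* $V$ if there is an algebraic set $\mathbb{V}\subseteq\mathbb{R}^d$ such that $S^c\cap V\subseteq\mathbb{V}\cap V$ and $\mathbb{V}^c\cap V$ is dense in $V$ in the Euclidean topology. For subsets of a finite-dimensional $\mathbb{K}$-vector space the notion is defined by identifying that space with some $\mathbb{R}^d$ through a real-linear isomorphism (the choice of which is immaterial). *Reference sets.* With $E,Q\in\mathbb{K}^{\ell\times n}$, $J,R\in\mathbb{K}^{\ell\times\ell}$, $B\in\mathbb{K}^{\ell\times m}$, and $M^*$ the conjugate transpose of $M$, put $$\Sigma^{H}=\{(E,J,Q,B)\mid J=-J^*,\ E^*Q=Q^*E\ge 0\},$$ $$\Sigma^{sdH}=\{(E,J,R,Q,B)\mid J=-J^*,\ R=R^*\ge 0,\ E^*Q=Q^*E\ge 0\},$$ $$\Sigma^{dH}=\{(E,J,R,Q,B)\mid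 J=-J^*,\ R=R^*> 0,\ E^*Q=Q^*E\ge 0\},$$ where $\ge 0$ and $>0$ mean positive semidefinite and positive definite. Then the following hold. 1. Each of the sets - (a) $S_{(a)}=\{(E,J,Q,B)\mid \operatorname{rk}[E,B]=\min\{\ell,n+m\}\}$, - (b) $S_{(b)}=\{(E,J,Q,B)\mid \operatorname{rk}[E,JQ,B]=\min\{\ell,2n+m\}\}$, - (c) $S_{(c)}=\{(E,J,Q,B)\mid \operatorname{rk}_{\mathbb{K}(x)}[xE-JQ,B]=\min\{\ell,n+m\}\}$, - (d) $S_{(d)}=\{(E,J,Q,B)\mid \operatorname{rk}[E,JQZ,B]=\min\{\ell,n+m\}$ for all $Z\in\mathbb{K}^{n\times(n-\operatorname{rk}E)}$ with $\operatorname{im}Z=\ker E\}$ is relative generic in $\Sigma^{H}$. 2. Each of the sets - (e) $S_{(e)}=\{(E,J,R,Q,B)\mid \operatorname{rk}[E,B]=\min\{\ell,n+m\}\}$, - (f) $S_{(f)}=\{(E,J,R,Q,B)\mid \operatorname{rk}[E,(J-R)Q,B]=\min\{\ell,2n+m\}\}$, - (g) $S_{(g)}=\{(E,J,R,Q,B)\mid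 \operatorname{rk}_{\mathbb{K}(x)}[xE-(J-R)Q,B]=\min\{\ell,n+m\}\}$, - (h) $S_{(h)}=\{(E,J,R,Q,B)\mid \operatorname{rk}[E,(J-R)QZ,B]=\min\{\ell,n+m\}$ for all $Z\in\mathbb{K}^{n\times(n-\operatorname{rk}E)}$ with $\operatorname{im}Z=\ker E\}$ is relative generic in $\Sigma^{sdH}$ and in $\Sigma^{dH}$. 3. The set - (i) $S_{(i)}=\{(E,J,Q,B)\mid \forall\lambda\in\mathbb{C}:\ \operatorname{rk}_{\mathbb{C}}[\lambda E-JQ,B]=\min\{\ell,n+m\}\}$ is relative generic in $\Sigma^{H}$ if and only if $\ell\neq n+m$; if $\ell=n+m$, its complement is relative generic in $\Sigma^{H}$. The set - (j) $S_{(j)}=\{(E,J,R,Q,B)\mid \forall\lambda\in\mathbb{C}:\ \operatorname{rk}_{\mathbb{C}}[\lambda E-(J-R)Q,B]=\min\{\ell,n+m\}\}$ is relative generic in $\Sigma^{sdH}$ if and only if $\ell\neq n+m$; if $\ell=n+m$, its complement is relative generic in $\Sigma^{sdH}$. -/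

import Mathlib

open scoped ComplexOrder

noncomputable section

namespace PortHamiltonian

/-! ### Algebraic sets and relative genericity -/

/-- A subset of `ℝ^d` is algebraic if it is the set of common zeros of finitely many real
polynomials in `d` indeterminates. -/
def IsAlgebraicSet {d : ℕ} (A : Set (Fin d → ℝ)) : Prop :=
  ∃ s : Finset (MvPolynomial (Fin d) ℝ), A = {x | ∀ p ∈ s, MvPolynomial.eval x p = 0}

/-- `S` is relative generic in the reference set `V`, both subsets of `ℝ^d`: outside of some
algebraic set `A` every point of `V` lies in `S`, and `Aᶜ ∩ V` is Euclidean dense in `V`. -/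
def IsRelGenericReal {d : ℕ} (S V : Set (Fin d → ℝ)) : Prop :=
  ∃ A : Set (Fin d → ℝ), IsAlgebraicSet A ∧ Sᶜ ∩ V ⊆ A ∩ V ∧ V ⊆ closure (Aᶜ ∩ V)

/-- Relative genericity in a finite-dimensional real vector space `W` (for instance a complex
coordinate space, regarded as a real vector space), through a real-linear isomorphism of `W`
with some `ℝ^d`. By `isRelGeneric_iff` below the choice of the isomorphism is immaterial. -/
def IsRelGeneric {W : Type*} [AddCommGroup W] [Module ℝ W] [Module.Finite ℝ W]
    (S V : Set W) : Prop :=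
  IsRelGenericReal ((Module.finBasis ℝ W).equivFun '' S) ((Module.finBasis ℝ W).equivFun '' V)

/-- Preimages of algebraic sets under linear maps are algebraic. -/
theorem IsAlgebraicSet.preimage {d e : ℕ} {A : Set (Fin e → ℝ)} (hA : IsAlgebraicSet A)
    (f : (Fin d → ℝ) →ₗ[ℝ] (Fin e → ℝ)) : IsAlgebraicSet (f ⁻¹' A) := by
  classical
  obtain ⟨s, rfl⟩ := hA
  let g : Fin e → MvPolynomial (Fin d) ℝ := fun j =>
    ∑ i, MvPolynomial.C (f (Pi.single i 1) j) * MvPolynomial.X i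
  have hg : ∀ x j, MvPolynomial.eval x (g j) = f x j := by
    intro x j
    have hx : f x = ∑ i, x i • f (Pi.single i 1) := by
      conv_lhs => rw [pi_eq_sum_univ' x]
      simp [map_sum, map_smul]
    rw [hx]
    simp [g, Finset.sum_apply, mul_comm]
  refine ⟨s.image (MvPolynomial.bind₁ g), ?_⟩
  ext x
  have key : ∀ p, MvPolynomial.eval x (MvPolynomial.bind₁ g p) = MvPolynomial.eval (f x) p := by
    intro p
    rw [MvPolynomial.eval, MvPolynomial.eval₂Hom_bind₁]
    have : (fun i => (MvPolynomial.eval₂Hom (RingHom.id ℝ) x) (g i)) = f x := funext (hg x)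
    rw [this]
    rfl
  simp [key]

theorem IsRelGenericReal.image {d e : ℕ} {S V : Set (Fin d → ℝ)} (h : IsRelGenericReal S V)
    (f : (Fin d → ℝ) ≃ₗ[ℝ] (Fin e → ℝ)) : IsRelGenericReal (f '' S) (f '' V) := by
  obtain ⟨A, hA, hS, hV⟩ := h
  have hfA : (f.symm : (Fin e → ℝ) →ₗ[ℝ] (Fin d → ℝ)) ⁻¹' A = f '' A :=
    (f.toEquiv.image_eq_preimage_symm A).symm
  refine ⟨f '' A, hfA ▸ hA.preimage (f.symm : (Fin e → ℝ) →ₗ[ℝ] (Fin d → ℝ)), ?_, ?_⟩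
  · rw [← Set.image_compl_eq f.bijective, ← Set.image_inter f.injective,
      ← Set.image_inter f.injective]
    exact Set.image_mono hS
  · rw [← Set.image_compl_eq f.bijective, ← Set.image_inter f.injective]
    have hc : Continuous f := (f : (Fin d → ℝ) →ₗ[ℝ] (Fin e → ℝ)).continuous_of_finiteDimensional
    exact (Set.image_mono hV).trans (image_closure_subset_closure_image hc)

/-- Relative genericity does not depend on the isomorphism used to define it. -/
theorem isRelGeneric_iff {W : Type*} [AddCommGroup W] [Module ℝ W] [Module.Finite ℝ W]
    (S V : Set W) {d : ℕ} (φ : W ≃ₗ[ℝ] (Fin d → ℝ)) :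
    IsRelGeneric S V ↔ IsRelGenericReal (φ '' S) (φ '' V) := by
  constructor
  · intro h
    have := IsRelGenericReal.image h ((Module.finBasis ℝ W).equivFun.symm.trans φ)
    simpa [Set.image_image] using this
  · intro h
    have := IsRelGenericReal.image h (φ.symm.trans (Module.finBasis ℝ W).equivFun)
    simp only [Set.image_image, LinearEquiv.trans_apply, LinearEquiv.symm_apply_apply] at this
    exact this

/-! ### Port-Hamiltonian matrix tuples -/

variable (𝕜 : Type*) [RCLike 𝕜] (ℓ n m : ℕ)

/-- Quadruples `(E, J, Q, B)` of matrices. -/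
abbrev Quadruple : Type _ :=
  Matrix (Fin ℓ) (Fin n) 𝕜 × Matrix (Fin ℓ) (Fin ℓ) 𝕜 × Matrix (Fin ℓ) (Fin n) 𝕜 ×
    Matrix (Fin ℓ) (Fin m) 𝕜

/-- Quintuples `(E, J, R, Q, B)` of matrices. -/
abbrev Quintuple : Type _ :=
  Matrix (Fin ℓ) (Fin n) 𝕜 × Matrix (Fin ℓ) (Fin ℓ) 𝕜 × Matrix (Fin ℓ) (Fin ℓ) 𝕜 ×
    Matrix (Fin ℓ) (Fin n) 𝕜 × Matrix (Fin ℓ) (Fin m) 𝕜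

instance finite_matrix (a b : ℕ) : Module.Finite ℝ (Matrix (Fin a) (Fin b) 𝕜) :=
  inferInstanceAs (Module.Finite ℝ (Fin a → Fin b → 𝕜))

open Matrix in
/-- Conservative port-Hamiltonian systems. -/
def SigmaH : Set (Quadruple 𝕜 ℓ n m) :=
  {(E, J, Q, _B) : Quadruple 𝕜 ℓ n m | J = -Jᴴ ∧ Eᴴ * Q = Qᴴ * E ∧ (Eᴴ * Q).PosSemidef}

open Matrix in
/-- Semi-dissipative port-Hamiltonian systems. -/
def SigmaSdH : Set (Quintuple 𝕜 ℓ n m) :=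
  {(E, J, R, Q, _B) : Quintuple 𝕜 ℓ n m |
    J = -Jᴴ ∧ (R = Rᴴ ∧ R.PosSemidef) ∧ Eᴴ * Q = Qᴴ * E ∧ (Eᴴ * Q).PosSemidef}

open Matrix in
/-- Dissipative port-Hamiltonian systems. -/
def SigmaDH : Set (Quintuple 𝕜 ℓ n m) :=
  {(E, J, R, Q, _B) : Quintuple 𝕜 ℓ n m |
    J = -Jᴴ ∧ (R = Rᴴ ∧ R.PosDef) ∧ Eᴴ * Q = Qᴴ * E ∧ (Eᴴ * Q).PosSemidef}

/-! ### The rank conditions, for `[E, A, B]` with `E, A ∈ 𝕜^{ℓ × n}`, `B ∈ 𝕜^{ℓ × m}` -/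

variable {𝕜 ℓ n m}

/-- `rk [E, B] = min {ℓ, n + m}`. -/
def FullRankEB (E : Matrix (Fin ℓ) (Fin n) 𝕜) (B : Matrix (Fin ℓ) (Fin m) 𝕜) : Prop :=
  (Matrix.fromCols E B).rank = min ℓ (n + m)

/-- `rk [E, A, B] = min {ℓ, 2n + m}`. -/
def FullRankEAB (E A : Matrix (Fin ℓ) (Fin n) 𝕜) (B : Matrix (Fin ℓ) (Fin m) 𝕜) : Prop :=
  (Matrix.fromCols E (Matrix.fromCols A B)).rank = min ℓ (2 * n + m)

/-- `rk [xE - A, B] = min {ℓ, n + m}` over the field `𝕜(x)` of rational functions. -/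
def FullRankPencil (E A : Matrix (Fin ℓ) (Fin n) 𝕜) (B : Matrix (Fin ℓ) (Fin m) 𝕜) : Prop :=
  (Matrix.fromCols ((RatFunc.X : RatFunc 𝕜) • E.map RatFunc.C - A.map RatFunc.C)
    (B.map RatFunc.C)).rank = min ℓ (n + m)

/-- `rk [E, AZ, B] = min {ℓ, n + m}` for all `Z ∈ 𝕜^{n × (n - rk E)}` with `im Z = ker E`. -/
def FullRankKernel (E A : Matrix (Fin ℓ) (Fin n) 𝕜) (B : Matrix (Fin ℓ) (Fin m) 𝕜) : Prop :=
  ∀ Z : Matrix (Fin n) (Fin (n - E.rank)) 𝕜,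
    LinearMap.range Z.mulVecLin = LinearMap.ker E.mulVecLin →
      (Matrix.fromCols E (Matrix.fromCols (A * Z) B)).rank = min ℓ (n + m)

/-- `rk [λE - A, B] = min {ℓ, n + m}` over `ℂ` for all `λ ∈ ℂ`. Here `RCLike.map 𝕜 ℂ` is the
inclusion `ℝ ⊆ ℂ` if `𝕜 = ℝ`, and the identity if `𝕜 = ℂ`. -/
def FullRankPointwise (E A : Matrix (Fin ℓ) (Fin n) 𝕜) (B : Matrix (Fin ℓ) (Fin m) 𝕜) : Prop :=
  ∀ z : ℂ, (Matrix.fromCols (z • E.map (RCLike.map 𝕜 ℂ) - A.map (RCLike.map 𝕜 ℂ))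
    (B.map (RCLike.map 𝕜 ℂ))).rank = min ℓ (n + m)

variable (𝕜 ℓ n m)

/-! ### The subsets of the spaces of matrix quadruples and quintuples -/

def Sa : Set (Quadruple 𝕜 ℓ n m) :=
  {(E, _J, _Q, B) : Quadruple 𝕜 ℓ n m | FullRankEB E B}

def Sb : Set (Quadruple 𝕜 ℓ n m) :=
  {(E, J, Q, B) : Quadruple 𝕜 ℓ n m | FullRankEAB E (J * Q) B}

def Sc : Set (Quadruple 𝕜 ℓ n m) :=
  {(E, J, Q, B) : Quadruple 𝕜 ℓ n m | FullRankPencil E (J * Q) B}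

def Sd : Set (Quadruple 𝕜 ℓ n m) :=
  {(E, J, Q, B) : Quadruple 𝕜 ℓ n m | FullRankKernel E (J * Q) B}

def Se : Set (Quintuple 𝕜 ℓ n m) :=
  {(E, _J, _R, _Q, B) : Quintuple 𝕜 ℓ n m | FullRankEB E B}

def Sf : Set (Quintuple 𝕜 ℓ n m) :=
  {(E, J, R, Q, B) : Quintuple 𝕜 ℓ n m | FullRankEAB E ((J - R) * Q) B}

def Sg : Set (Quintuple 𝕜 ℓ n m) :=
  {(E, J, R, Q, B) : Quintuple 𝕜 ℓ n m | FullRankPencil E ((J - R) * Q) B}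

def Sh : Set (Quintuple 𝕜 ℓ n m) :=
  {(E, J, R, Q, B) : Quintuple 𝕜 ℓ n m | FullRankKernel E ((J - R) * Q) B}

def Si : Set (Quadruple 𝕜 ℓ n m) :=
  {(E, J, Q, B) : Quadruple 𝕜 ℓ n m | FullRankPointwise E (J * Q) B}

def Sj : Set (Quintuple 𝕜 ℓ n m) :=
  {(E, J, R, Q, B) : Quintuple 𝕜 ℓ n m | FullRankPointwise E ((J - R) * Q) B}

end PortHamiltonian

end

/-!
Each reference set has a dense subset that is a polynomial image of a convex set: keep the other
matrices and put `Q = K E` for a positive semidefinite `K`. A polynomial that vanishes on a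
nonempty relatively open part of a convex set vanishes on all of it, so a condition is generic in
a reference set as soon as it is implied by the non-vanishing of a polynomial `p` that is nonzero
at one point of the form `Q = K E`, where for definite `R` also `R = 0` is allowed. For `p` we take
the Gram determinant `det (Nᴴ N)`, where `N` depends linearly on `E`, `A = J Q` or
`A = (J - R) Q`, and `B`; the witness has `R = 0` and `Q = E`, with columns of `E` and `B` unit
vectors.

For the rank of `[λE - A, B]` at all `λ ∈ ℂ` simultaneously, `N` is the matrix of the chains
`E x_{i+1} - A x_i + B y_i = 0` of a fixed length, or of their transposes. If all the
`[λE - A, B]` and `[E, B]` have trivial kernel, the heads of the chains form a decreasing sequence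
of subspaces, whose limit `S` satisfies `A S ⊆ E S` modulo the range of `B`; an eigenvector of
`A` relative to `E` on `S` would contradict the hypothesis, so the long chains are trivial. A
witness is `J` tridiagonal: by its three-term recurrence an eigenvector vanishes if its first
entry does, and `E` and `B` are chosen so as to force this. In the square case `ℓ = n + m` the
argument breaks down: `[E, B]` is generically invertible, and then `E⁻¹ A` modulo the range of `B`
has an eigenvalue.
-/

open scoped ComplexOrder

noncomputable section

namespace PortHamiltonian

section Polynomial

variable {U V V' W : Type*} [AddCommGroup U] [Module ℝ U] [AddCommGroup V] [Module ℝ V]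
  [AddCommGroup V'] [Module ℝ V'] [AddCommGroup W] [Module ℝ W]

variable (W) in
/-- The polynomial functions on a real vector space: the algebra generated by its linear
functionals. -/
def polyFun : Subalgebra ℝ (W → ℝ) :=
  Algebra.adjoin ℝ (Set.range fun g : W →ₗ[ℝ] ℝ => ⇑g)

theorem linear_mem_polyFun (g : W →ₗ[ℝ] ℝ) : ⇑g ∈ polyFun W :=
  Algebra.subset_adjoin ⟨g, rfl⟩

/-- Polynomial maps between real vector spaces, defined without coordinates: linear functionals
pull back to polynomial functions. -/
def IsPolyMap (f : U → W) : Prop :=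
  ∀ g : W →ₗ[ℝ] ℝ, (fun u => g (f u)) ∈ polyFun U

theorem IsPolyMap.comp_mem_polyFun {Φ : U → W} (hΦ : IsPolyMap Φ) {f : W → ℝ}
    (hf : f ∈ polyFun W) : (fun u => f (Φ u)) ∈ polyFun U := by
  induction hf using Algebra.adjoin_induction with
  | mem f hf => obtain ⟨g, rfl⟩ := hf; exact hΦ g
  | algebraMap r => exact (polyFun U).algebraMap_mem r
  | add f g _ _ hf hg => exact add_mem hf hg
  | mul f g _ _ hf hg => exact mul_mem hf hg

namespace IsPolyMap

theorem comp {Ψ : V → W} {Φ : U → V} (hΨ : IsPolyMap Ψ) (hΦ : IsPolyMap Φ) :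
    IsPolyMap fun u => Ψ (Φ u) :=
  fun g => hΦ.comp_mem_polyFun (hΨ g)

theorem of_isLinearMap {f : U → W} (hf : IsLinearMap ℝ f) : IsPolyMap f :=
  fun g => linear_mem_polyFun (g ∘ₗ hf.mk' f)

theorem linear (f : U →ₗ[ℝ] W) : IsPolyMap f :=
  of_isLinearMap f.isLinear

theorem const (w : W) : IsPolyMap fun _ : U => w :=
  fun g => (polyFun U).algebraMap_mem (g w)

theorem add {f g : U → W} (hf : IsPolyMap f) (hg : IsPolyMap g) :
    IsPolyMap fun u => f u + g u := fun L => by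
  simp only [map_add]
  exact add_mem (hf L) (hg L)

theorem sum {ι : Type*} {s : Finset ι} {f : ι → U → W} (hf : ∀ i ∈ s, IsPolyMap (f i)) :
    IsPolyMap fun u => ∑ i ∈ s, f i u := fun g => by
  simpa only [map_sum, Finset.sum_fn] using sum_mem fun i hi => hf i hi g

theorem prodMk {f : U → V} {g : U → W} (hf : IsPolyMap f) (hg : IsPolyMap g) :
    IsPolyMap fun u => (f u, g u) := by
  simpa using ((linear (.inl ℝ V W)).comp hf).add ((linear (.inr ℝ V W)).comp hg)

theorem fst : IsPolyMap (Prod.fst : U × V → U) := linear (.fst ℝ U V)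

theorem bilinear [Module.Finite ℝ V] (L : V →ₗ[ℝ] V' →ₗ[ℝ] W) {f : U → V} {g : U → V'}
    (hf : IsPolyMap f) (hg : IsPolyMap g) : IsPolyMap fun u => L (f u) (g u) := fun h => by
  let b := Module.finBasis ℝ V
  have hL (u : U) : h (L (f u) (g u)) = ∑ i, b.coord i (f u) * (h ∘ₗ L (b i)) (g u) := by
    conv_lhs => rw [← b.sum_repr (f u)]
    simp only [map_sum, map_smul, LinearMap.sum_apply, LinearMap.smul_apply, smul_eq_mul,
      Module.Basis.coord_apply, LinearMap.comp_apply]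
  simp only [hL, ← Finset.sum_fn]
  exact sum_mem fun i _ => mul_mem (hf (b.coord i)) (hg (h ∘ₗ L (b i)))

theorem prod {A ι : Type*} [CommRing A] [Algebra ℝ A] [Module.Finite ℝ A] {s : Finset ι}
    {f : ι → U → A} (hf : ∀ i ∈ s, IsPolyMap (f i)) : IsPolyMap fun u => ∏ i ∈ s, f i u := by
  classical
  induction s using Finset.induction_on with
  | empty => simpa using const 1
  | insert i s hi ih =>
    simp only [Finset.prod_insert hi]
    exact bilinear (LinearMap.mul ℝ A) (hf i (s.mem_insert_self i))
      (ih fun j hj => hf j (Finset.mem_insert_of_mem hj))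

theorem det {A ι : Type*} [CommRing A] [Algebra ℝ A] [Module.Finite ℝ A] [Fintype ι]
    [DecidableEq ι] : IsPolyMap fun M : Matrix ι ι A => M.det := by
  simp only [Matrix.det_apply']
  exact sum fun σ _ => (linear (LinearMap.mulLeft ℝ _)).comp
    (prod fun i _ => linear (Matrix.entryLinearMap ℝ A (σ i) i))

theorem matrixMul {A ι κ τ : Type*} [CommRing A] [Algebra ℝ A] [Module.Finite ℝ A] [Finite ι]
    [Fintype κ] {f : U → Matrix ι κ A} {g : U → Matrix κ τ A} (hf : IsPolyMap f)
    (hg : IsPolyMap g) : IsPolyMap fun u => f u * g u :=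
  bilinear (mulLinearMap ℝ) hf hg

end IsPolyMap

section Continuity

variable [TopologicalSpace U] [IsTopologicalAddGroup U] [ContinuousSMul ℝ U] [T2Space U]
  [Module.Finite ℝ U]

theorem continuous_of_mem_polyFun {f : U → ℝ} (hf : f ∈ polyFun U) : Continuous f := by
  induction hf using Algebra.adjoin_induction with
  | mem f hf => obtain ⟨g, rfl⟩ := hf; exact g.continuous_of_finiteDimensional
  | algebraMap r => exact continuous_const
  | add f g _ _ hf hg => exact hf.add hg
  | mul f g _ _ hf hg => exact hf.mul hg

theorem IsPolyMap.continuous [TopologicalSpace W] [IsTopologicalAddGroup W] [ContinuousSMul ℝ W]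
    [T2Space W] [Module.Finite ℝ W] {Φ : U → W} (hΦ : IsPolyMap Φ) : Continuous Φ := by
  let b := Module.finBasis ℝ W
  refine b.equivFunL.toHomeomorph.comp_continuous_iff.1 (continuous_pi fun i => ?_)
  exact continuous_of_mem_polyFun (hΦ (b.coord i))

end Continuity

theorem exists_mvPolynomial_eval_eq [Module.Finite ℝ W] {f : W → ℝ} (hf : f ∈ polyFun W) :
    ∃ p : MvPolynomial (Fin (Module.finrank ℝ W)) ℝ,
      ∀ w, MvPolynomial.eval ((Module.finBasis ℝ W).equivFun w) p = f w := by
  induction hf using Algebra.adjoin_induction with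
  | mem f hf =>
    obtain ⟨g, rfl⟩ := hf
    refine ⟨∑ i, .C (g (Module.finBasis ℝ W i)) * .X i, fun w => ?_⟩
    conv_rhs => rw [← (Module.finBasis ℝ W).sum_repr w]
    simp only [map_sum, map_mul, map_smul, MvPolynomial.eval_C, MvPolynomial.eval_X,
      Module.Basis.equivFun_apply, smul_eq_mul, mul_comm]
  | algebraMap r => exact ⟨.C r, fun w => MvPolynomial.eval_C r⟩
  | add f g _ _ hf hg =>
    obtain ⟨⟨p, hp⟩, ⟨q, hq⟩⟩ := hf, hg
    exact ⟨p + q, fun w => by simp only [map_add, hp, hq, Pi.add_apply]⟩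
  | mul f g _ _ hf hg =>
    obtain ⟨⟨p, hp⟩, ⟨q, hq⟩⟩ := hf, hg
    exact ⟨p * q, fun w => by simp only [map_mul, hp, hq, Pi.mul_apply]⟩

theorem exists_polynomial_eval_eq {f : ℝ → ℝ} (hf : f ∈ polyFun ℝ) :
    ∃ p : Polynomial ℝ, ∀ t, p.eval t = f t := by
  induction hf using Algebra.adjoin_induction with
  | mem f hf =>
    obtain ⟨g, rfl⟩ := hf
    exact ⟨.C (g 1) * .X, fun t => by
      rw [Polynomial.eval_mul, Polynomial.eval_C, Polynomial.eval_X, mul_comm, ← smul_eq_mul,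
        ← map_smul, smul_eq_mul, mul_one]⟩
  | algebraMap r => exact ⟨.C r, fun t => Polynomial.eval_C⟩
  | add f g _ _ hf hg =>
    obtain ⟨⟨p, hp⟩, ⟨q, hq⟩⟩ := hf, hg
    exact ⟨p + q, fun t => by simp only [Polynomial.eval_add, hp, hq, Pi.add_apply]⟩
  | mul f g _ _ hf hg =>
    obtain ⟨⟨p, hp⟩, ⟨q, hq⟩⟩ := hf, hg
    exact ⟨p * q, fun t => by simp only [Polynomial.eval_mul, hp, hq, Pi.mul_apply]⟩

open Filter Topology

theorem eventually_lineMap_ne_zero {f : U → ℝ} (hf : f ∈ polyFun U) (x : U) {y : U}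
    (hy : f y ≠ 0) : ∀ᶠ t : ℝ in 𝓝[>] 0, f (AffineMap.lineMap x y t) ≠ 0 := by
  have hline : IsPolyMap fun t : ℝ => AffineMap.lineMap x y t := by
    simp only [AffineMap.lineMap_apply_module']
    exact (IsPolyMap.linear (LinearMap.toSpanSingleton ℝ U (y - x))).add (.const x)
  obtain ⟨p, hp⟩ := exists_polynomial_eval_eq (hline.comp_mem_polyFun hf)
  have hp0 : p ≠ 0 := by
    rintro rfl
    exact hy (by simpa using (hp 1).symm)
  have hroots : ∀ᶠ t in 𝓝[≠] (0 : ℝ), ¬ p.IsRoot t :=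
    nhdsNE_le_cofinite 0 (Polynomial.finite_setOfPred_isRoot hp0).eventually_cofinite_notMem
  filter_upwards [hroots.filter_mono (nhdsWithin_mono _ fun t ht => ne_of_gt ht)] with t ht
  rwa [← hp]

end Polynomial

section Criteria

open Filter Topology

variable {U W : Type*} [AddCommGroup U] [Module ℝ U] [Module.Finite ℝ U]
  [TopologicalSpace U] [IsTopologicalAddGroup U] [ContinuousSMul ℝ U] [T2Space U]
  [AddCommGroup W] [Module ℝ W] [Module.Finite ℝ W]

theorem subset_closure_ne_zero_of_convex {C : Set U} (hC : Convex ℝ C) {f : U → ℝ}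
    (hf : f ∈ polyFun U) {u : U} (hu : u ∈ closure C) (hfu : f u ≠ 0) :
    C ⊆ closure (C ∩ {x | f x ≠ 0}) := by
  intro x hx
  have hopen : IsOpen {x | f x ≠ 0} := isOpen_ne_fun (continuous_of_mem_polyFun hf) continuous_const
  obtain ⟨y, hy, hyC⟩ := mem_closure_iff.1 hu _ hopen hfu
  have hlim : Tendsto (AffineMap.lineMap x y : ℝ → U) (𝓝[>] 0) (𝓝 x) := by
    have h := (AffineMap.lineMap_continuous (p := x) (q := y)).tendsto (0 : ℝ)
    rw [AffineMap.lineMap_apply_zero] at h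
    exact h.mono_left nhdsWithin_le_nhds
  refine mem_closure_of_tendsto hlim ?_
  filter_upwards [eventually_lineMap_ne_zero hf x hy, Ioo_mem_nhdsGT (zero_lt_one (α := ℝ))]
    with t hne ht
  exact ⟨hC.lineMap_mem hx hyC ⟨ht.1.le, ht.2.le⟩, hne⟩

theorem IsAlgebraicSet.isClosed {d : ℕ} {A : Set (Fin d → ℝ)} (hA : IsAlgebraicSet A) :
    IsClosed A := by
  obtain ⟨s, rfl⟩ := hA
  simp only [Set.ofPred_forall]
  exact isClosed_iInter fun p => isClosed_iInter fun _ =>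
    isClosed_eq (MvPolynomial.continuous_eval p) continuous_const

theorem IsRelGeneric.not_compl {S V : Set W} (hV : V.Nonempty) (h : IsRelGeneric S V) :
    ¬ IsRelGeneric Sᶜ V := by
  rintro ⟨A', -, hS', hdense'⟩
  obtain ⟨A, hA, hS, hdense⟩ := h
  let e := (Module.finBasis ℝ W).equivFun
  obtain ⟨v, hv⟩ := hV
  obtain ⟨_, -, hy, hyV⟩ := mem_closure_iff.1 (hdense ⟨v, hv, rfl⟩) _ isOpen_univ trivial
  obtain ⟨_, hwA, hwA', w, hw, rfl⟩ :=
    mem_closure_iff.1 (hdense' hyV) _ hA.isClosed.isOpen_compl hy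
  have hwS : e w ∈ e '' S := by
    by_contra hne
    exact hwA (hS ⟨hne, w, hw, rfl⟩).1
  have hwS' : e w ∈ e '' Sᶜ := by
    by_contra hne
    exact hwA' (hS' ⟨hne, w, hw, rfl⟩).1
  exact e.injective.mem_set_image.1 hwS' (e.injective.mem_set_image.1 hwS)

variable [TopologicalSpace W] [IsTopologicalAddGroup W] [ContinuousSMul ℝ W] [T2Space W]

theorem IsRelGeneric.of_polyFun {S V : Set W} {f : W → ℝ} (hf : f ∈ polyFun W)
    (hS : ∀ v ∈ V, f v ≠ 0 → v ∈ S) (hV : V ⊆ closure (V ∩ {v | f v ≠ 0})) :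
    IsRelGeneric S V := by
  obtain ⟨p, hp⟩ := exists_mvPolynomial_eval_eq hf
  let e := (Module.finBasis ℝ W).equivFun
  have he : Continuous e := e.toLinearMap.continuous_of_finiteDimensional
  refine ⟨{x | ∀ q ∈ ({p} : Finset _), MvPolynomial.eval x q = 0}, ⟨{p}, rfl⟩, ?_, ?_⟩
  · rintro _ ⟨hx, v, hv, rfl⟩
    refine ⟨?_, v, hv, rfl⟩
    simp only [Finset.mem_singleton, forall_eq, Set.mem_ofPred_eq, hp]
    by_contra hne
    exact hx ⟨v, hS v hv hne, rfl⟩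
  · refine (Set.image_mono hV).trans
      ((image_closure_subset_closure_image he).trans (closure_mono ?_))
    rintro _ ⟨v, ⟨hv, hne⟩, rfl⟩
    simp only [Set.mem_ofPred_eq, ← hp] at hne
    exact ⟨fun h => hne (h p (Finset.mem_singleton_self p)), v, hv, rfl⟩

theorem IsRelGeneric.of_convex_image {S V : Set W} {C : Set U} (hC : Convex ℝ C) {Φ : U → W}
    (hΦ : IsPolyMap Φ) (hmaps : Set.MapsTo Φ C V) (hdense : V ⊆ closure (Φ '' C)) {f : W → ℝ}
    (hf : f ∈ polyFun W) (hS : ∀ v ∈ V, f v ≠ 0 → v ∈ S) {u : U} (hu : u ∈ closure C)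
    (hfu : f (Φ u) ≠ 0) : IsRelGeneric S V := by
  refine .of_polyFun hf hS (hdense.trans (closure_minimal ?_ isClosed_closure))
  calc Φ '' C ⊆ Φ '' closure (C ∩ {x | f (Φ x) ≠ 0}) :=
        Set.image_mono (subset_closure_ne_zero_of_convex hC (hΦ.comp_mem_polyFun hf) hu hfu)
    _ ⊆ closure (Φ '' (C ∩ {x | f (Φ x) ≠ 0})) :=
        image_closure_subset_closure_image hΦ.continuous
    _ ⊆ closure (V ∩ {v | f v ≠ 0}) :=
        closure_mono (Set.image_subset_iff.2 fun x hx => ⟨hmaps hx.1, hx.2⟩)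

end Criteria

section Gram

open Matrix

variable {𝕜 ι κ : Type*} [RCLike 𝕜] [Fintype ι] [Fintype κ] [DecidableEq κ]

/-- The real part of the Gram determinant of the columns of a matrix, a polynomial certificate
for injectivity. The determinant is real, so the real part loses nothing. -/
def gramDet (M : Matrix ι κ 𝕜) : ℝ :=
  RCLike.re (Mᴴ * M).det

theorem gramDet_ne_zero_iff {M : Matrix ι κ 𝕜} :
    gramDet M ≠ 0 ↔ Function.Injective M.mulVec := by
  refine ⟨fun h => ?_, fun h => ?_⟩
  · have hdet : (Mᴴ * M).det ≠ 0 := fun h0 => h (by rw [gramDet, h0, map_zero])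
    have hinj := mulVec_injective_of_det_ne_zero hdet
    refine Function.Injective.of_comp (f := Mᴴ.mulVec) ?_
    simpa only [Function.comp_def, mulVec_mulVec] using hinj
  · exact (RCLike.pos_iff.1 (PosDef.conjTranspose_mul_self M h).det_pos).1.ne'

theorem gramDet_mem_polyFun : gramDet ∈ polyFun (Matrix ι κ 𝕜) := by
  have hstar : IsLinearMap ℝ fun M : Matrix ι κ 𝕜 => Mᴴ :=
    ⟨conjTranspose_add, fun c M => by rw [conjTranspose_smul, star_trivial]⟩
  have hgram : IsPolyMap fun M : Matrix ι κ 𝕜 => Mᴴ * M :=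
    .matrixMul (.of_isLinearMap hstar) (.linear LinearMap.id)
  exact (IsPolyMap.det.comp hgram) RCLike.reLm

end Gram

section PosSemidef

open Matrix Filter Topology

variable {𝕜 ι κ : Type*} [RCLike 𝕜]

theorem convex_skewHermitian : Convex ℝ {J : Matrix ι ι 𝕜 | J = -Jᴴ} := by
  rw [convex_iff_forall_pos]
  intro J hJ L hL a b _ _ _
  simp only [Set.mem_ofPred_eq] at hJ hL ⊢
  rw [conjTranspose_add, conjTranspose_smul, conjTranspose_smul, star_trivial, star_trivial,
    neg_add, ← smul_neg, ← smul_neg, ← hJ, ← hL]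

theorem convex_posSemidef : Convex ℝ {K : Matrix ι ι 𝕜 | K.PosSemidef} :=
  convex_iff_forall_pos.2 fun _ hK _ hL _ _ ha hb _ => (hK.smul ha.le).add (hL.smul hb.le)

theorem convex_posDef : Convex ℝ {K : Matrix ι ι 𝕜 | K.PosDef} :=
  convex_iff_forall_pos.2 fun _ hK _ hL _ _ ha hb _ => (hK.smul ha).add (hL.smul hb)

theorem zero_mem_closure_posDef [Finite ι] : 0 ∈ closure {K : Matrix ι ι 𝕜 | K.PosDef} := by
  classical
  have hlim : Tendsto (fun t : ℝ => t • (1 : Matrix ι ι 𝕜)) (𝓝[>] 0) (𝓝 0) := by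
    have h : ContinuousAt (fun t : ℝ => t • (1 : Matrix ι ι 𝕜)) 0 := by fun_prop
    simpa using h.tendsto.mono_left nhdsWithin_le_nhds
  refine mem_closure_of_tendsto hlim ?_
  filter_upwards [self_mem_nhdsWithin] with t ht using PosDef.one.smul ht

variable [Fintype ι]

section

variable [Fintype κ]

theorem exists_posSemidef_mul_mul_self_eq {M : Matrix κ κ 𝕜} (hM : M.PosSemidef) :
    ∃ G : Matrix κ κ 𝕜, G.PosSemidef ∧ M * G * M = M := by
  classical
  let U : Matrix κ κ 𝕜 := hM.isHermitian.eigenvectorUnitary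
  let μ := hM.isHermitian.eigenvalues
  let D : Matrix κ κ 𝕜 := diagonal (RCLike.ofReal ∘ μ)
  let D' : Matrix κ κ 𝕜 := diagonal (RCLike.ofReal ∘ μ⁻¹)
  have hU : Uᴴ * U = 1 := Unitary.coe_star_mul_self hM.isHermitian.eigenvectorUnitary
  have hMU : M = U * D * Uᴴ := by
    have h := hM.isHermitian.spectral_theorem
    rwa [Unitary.conjStarAlgAut_apply] at h
  have hD : D * D' * D = D := by
    simp only [D, D', diagonal_mul_diagonal, Function.comp_apply, Pi.inv_apply,
      ← RCLike.ofReal_mul, mul_inv_mul_cancel]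
    rfl
  refine ⟨U * D' * Uᴴ, ?_, ?_⟩
  · refine (PosSemidef.diagonal fun i => ?_).mul_mul_conjTranspose_same U
    simpa using hM.eigenvalues_nonneg i
  · calc M * (U * D' * Uᴴ) * M = U * (D * (Uᴴ * U) * D' * (Uᴴ * U) * D) * Uᴴ := by
          rw [hMU]; simp only [Matrix.mul_assoc]
      _ = M := by rw [hU, Matrix.mul_one, Matrix.mul_one, hD, ← hMU]

theorem exists_posSemidef_mul_eq {F Q : Matrix ι κ 𝕜} (h : (Fᴴ * Q).PosSemidef)
    (hker : ∀ x, (Fᴴ * Q) *ᵥ x = 0 → Q *ᵥ x = 0) :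
    ∃ K : Matrix ι ι 𝕜, K.PosSemidef ∧ K * F = Q := by
  classical
  obtain ⟨G, hG, hMG⟩ := exists_posSemidef_mul_mul_self_eq h
  have hherm : Qᴴ * F = Fᴴ * Q := by
    simpa only [conjTranspose_mul, conjTranspose_conjTranspose] using h.isHermitian.eq
  refine ⟨Q * G * Qᴴ, hG.mul_mul_conjTranspose_same Q, ext_of_mulVec_single fun j => ?_⟩
  have hzero : (Fᴴ * Q) *ᵥ ((G * (Fᴴ * Q)) *ᵥ Pi.single j 1 - Pi.single j 1) = 0 := by
    rw [mulVec_sub, mulVec_mulVec, ← Matrix.mul_assoc, hMG, sub_self]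
  rw [Matrix.mul_assoc, hherm, Matrix.mul_assoc, ← mulVec_mulVec, ← sub_eq_zero, ← mulVec_sub]
  exact hker _ hzero

theorem mulVec_eq_zero_of_conjTranspose_add_smul_mul {E Q : Matrix ι κ 𝕜}
    (h : (Eᴴ * Q).PosSemidef) {t : ℝ} (ht : 0 < t) {x : κ → 𝕜}
    (hx : ((E + t • Q)ᴴ * Q) *ᵥ x = 0) : Q *ᵥ x = 0 := by
  have hQ := posSemidef_conjTranspose_mul_self Q
  have hsum : star x ⬝ᵥ ((Eᴴ * Q) *ᵥ x) + star x ⬝ᵥ ((t • (Qᴴ * Q)) *ᵥ x) = 0 := by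
    rw [← dotProduct_add, ← add_mulVec, ← smul_mul, ← Matrix.add_mul, ← star_trivial t,
      ← conjTranspose_smul, ← conjTranspose_add, hx, dotProduct_zero]
  have hzero := ((add_eq_zero_iff_of_nonneg (h.dotProduct_mulVec_nonneg x)
    ((hQ.smul ht.le).dotProduct_mulVec_nonneg x)).1 hsum).2
  rw [smul_mulVec, dotProduct_smul, smul_eq_zero_iff_right ht.ne', ← mulVec_mulVec,
    dotProduct_mulVec, ← star_mulVec] at hzero
  exact dotProduct_star_self_eq_zero.1 hzero

end

variable [Finite κ]

theorem mem_closure_image_mul_posSemidef {E Q : Matrix ι κ 𝕜} (h : (Eᴴ * Q).PosSemidef) :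
    (E, Q) ∈ closure {(F, Q') : Matrix ι κ 𝕜 × Matrix ι κ 𝕜 |
      ∃ K : Matrix ι ι 𝕜, K.PosSemidef ∧ K * F = Q'} := by
  have := Fintype.ofFinite κ
  have hlim : Tendsto (fun t : ℝ => (E + t • Q, Q)) (𝓝[>] 0) (𝓝 (E, Q)) := by
    have h : ContinuousAt (fun t : ℝ => (E + t • Q, Q)) 0 := by fun_prop
    simpa using h.tendsto.mono_left nhdsWithin_le_nhds
  refine mem_closure_of_tendsto hlim ?_
  filter_upwards [self_mem_nhdsWithin] with t ht
  refine exists_posSemidef_mul_eq ?_ fun x => mulVec_eq_zero_of_conjTranspose_add_smul_mul h ht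
  rw [conjTranspose_add, conjTranspose_smul, star_trivial, Matrix.add_mul, smul_mul]
  exact h.add ((posSemidef_conjTranspose_mul_self Q).smul ht.le)

theorem conjTranspose_mul_mul_comm_and_posSemidef {K : Matrix ι ι 𝕜} (hK : K.PosSemidef)
    (F : Matrix ι κ 𝕜) :
    Fᴴ * (K * F) = (K * F)ᴴ * F ∧ (Fᴴ * (K * F)).PosSemidef := by
  have := Fintype.ofFinite κ
  constructor
  · rw [conjTranspose_mul, hK.isHermitian.eq, Matrix.mul_assoc]
  · rw [← Matrix.mul_assoc]
    exact hK.conjTranspose_mul_mul_same F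

end PosSemidef

section GenericOnSigma

open Matrix

variable {𝕜 : Type*} [RCLike 𝕜] {ℓ n m : ℕ}
  {P : Matrix (Fin ℓ) (Fin n) 𝕜 → Matrix (Fin ℓ) (Fin n) 𝕜 → Matrix (Fin ℓ) (Fin m) 𝕜 → Prop}

variable (P) in
/-- The condition `P E A B`, imposed on `A = J * Q` or `A = (J - R) * Q`, is generic in each of
the three reference sets. -/
def GenericOnSigma : Prop :=
  IsRelGeneric {(E, J, Q, B) : Quadruple 𝕜 ℓ n m | P E (J * Q) B} (SigmaH 𝕜 ℓ n m) ∧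
    ∀ V ∈ ({SigmaSdH 𝕜 ℓ n m, SigmaDH 𝕜 ℓ n m} : Set (Set (Quintuple 𝕜 ℓ n m))),
      IsRelGeneric {(E, J, R, Q, B) : Quintuple 𝕜 ℓ n m | P E ((J - R) * Q) B} V

variable {𝕜' ι κ : Type*} [RCLike 𝕜'] [Finite ι] [Fintype κ]
  {N : Matrix (Fin ℓ) (Fin n) 𝕜 → Matrix (Fin ℓ) (Fin n) 𝕜 → Matrix (Fin ℓ) (Fin m) 𝕜 →
    Matrix ι κ 𝕜'}
  {E₁ : Matrix (Fin ℓ) (Fin n) 𝕜} {J₁ : Matrix (Fin ℓ) (Fin ℓ) 𝕜} {B₁ : Matrix (Fin ℓ) (Fin m) 𝕜}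

theorem isRelGeneric_sigmaH_of_injective
    (hN : IsLinearMap ℝ fun w : _ × _ × _ => N w.1 w.2.1 w.2.2)
    (hP : ∀ E A B, Function.Injective (N E A B).mulVec → P E A B)
    (hJ₁ : J₁ = -J₁ᴴ) (h₁ : Function.Injective (N E₁ (J₁ * E₁) B₁).mulVec) :
    IsRelGeneric {(E, J, Q, B) : Quadruple 𝕜 ℓ n m | P E (J * Q) B} (SigmaH 𝕜 ℓ n m) := by
  classical
  have := Fintype.ofFinite ι
  let C : Set (Matrix (Fin ℓ) (Fin n) 𝕜 × Matrix (Fin ℓ) (Fin ℓ) 𝕜 × Matrix (Fin ℓ) (Fin ℓ) 𝕜 ×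
      Matrix (Fin ℓ) (Fin m) 𝕜) :=
    Set.univ ×ˢ {J | J = -Jᴴ} ×ˢ {K | K.PosSemidef} ×ˢ Set.univ
  let Φ : Matrix (Fin ℓ) (Fin n) 𝕜 × Matrix (Fin ℓ) (Fin ℓ) 𝕜 × Matrix (Fin ℓ) (Fin ℓ) 𝕜 ×
      Matrix (Fin ℓ) (Fin m) 𝕜 → Quadruple 𝕜 ℓ n m := fun u => (u.1, u.2.1, u.2.2.1 * u.1, u.2.2.2)
  have hC : Convex ℝ C :=
    convex_univ.prod (convex_skewHermitian.prod (convex_posSemidef.prod convex_univ))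
  have hΦ : IsPolyMap Φ :=
    .prodMk .fst (.prodMk (.of_isLinearMap ⟨fun _ _ => rfl, fun _ _ => rfl⟩)
      (.prodMk (.matrixMul (.of_isLinearMap ⟨fun _ _ => rfl, fun _ _ => rfl⟩) .fst)
        (.of_isLinearMap ⟨fun _ _ => rfl, fun _ _ => rfl⟩)))
  have hcert : IsPolyMap fun v : Quadruple 𝕜 ℓ n m => N v.1 (v.2.1 * v.2.2.1) v.2.2.2 :=
    (IsPolyMap.of_isLinearMap hN).comp (.prodMk .fst (.prodMk
      (.matrixMul (.of_isLinearMap ⟨fun _ _ => rfl, fun _ _ => rfl⟩)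
        (.of_isLinearMap ⟨fun _ _ => rfl, fun _ _ => rfl⟩))
      (.of_isLinearMap ⟨fun _ _ => rfl, fun _ _ => rfl⟩)))
  refine .of_convex_image (u := (E₁, J₁, 1, B₁)) hC hΦ ?_ ?_
    (hcert.comp_mem_polyFun gramDet_mem_polyFun) (fun v _ h => hP _ _ _ (gramDet_ne_zero_iff.1 h))
    (subset_closure ⟨trivial, hJ₁, PosSemidef.one, trivial⟩) ?_
  · rintro ⟨E, J, K, B⟩ ⟨-, hJ, hK, -⟩
    exact ⟨hJ, conjTranspose_mul_mul_comm_and_posSemidef hK E⟩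
  · rintro ⟨E, J, Q, B⟩ ⟨hJ, -, hEQ⟩
    refine map_mem_closure (f := fun p : _ × _ => (p.1, J, p.2, B)) (by fun_prop)
      (mem_closure_image_mul_posSemidef hEQ) ?_
    rintro ⟨F, _⟩ ⟨K, hK, rfl⟩
    exact ⟨(F, J, K, B), ⟨trivial, hJ, hK, trivial⟩, rfl⟩
  · simpa only [Φ, Matrix.one_mul] using gramDet_ne_zero_iff.2 h₁

theorem isRelGeneric_dissipative_of_injective {𝓡 : Set (Matrix (Fin ℓ) (Fin ℓ) 𝕜)}
    (h𝓡 : Convex ℝ 𝓡) (h0 : 0 ∈ closure 𝓡)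
    (hN : IsLinearMap ℝ fun w : _ × _ × _ => N w.1 w.2.1 w.2.2)
    (hP : ∀ E A B, Function.Injective (N E A B).mulVec → P E A B)
    (hJ₁ : J₁ = -J₁ᴴ) (h₁ : Function.Injective (N E₁ (J₁ * E₁) B₁).mulVec) :
    IsRelGeneric {(E, J, R, Q, B) : Quintuple 𝕜 ℓ n m | P E ((J - R) * Q) B}
      {(E, J, R, Q, _B) : Quintuple 𝕜 ℓ n m |
        J = -Jᴴ ∧ R ∈ 𝓡 ∧ Eᴴ * Q = Qᴴ * E ∧ (Eᴴ * Q).PosSemidef} := by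
  classical
  have := Fintype.ofFinite ι
  let C : Set (Matrix (Fin ℓ) (Fin n) 𝕜 × Matrix (Fin ℓ) (Fin ℓ) 𝕜 × Matrix (Fin ℓ) (Fin ℓ) 𝕜 ×
      Matrix (Fin ℓ) (Fin ℓ) 𝕜 × Matrix (Fin ℓ) (Fin m) 𝕜) :=
    Set.univ ×ˢ {J | J = -Jᴴ} ×ˢ 𝓡 ×ˢ {K | K.PosSemidef} ×ˢ Set.univ
  let Φ : Matrix (Fin ℓ) (Fin n) 𝕜 × Matrix (Fin ℓ) (Fin ℓ) 𝕜 × Matrix (Fin ℓ) (Fin ℓ) 𝕜 ×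
      Matrix (Fin ℓ) (Fin ℓ) 𝕜 × Matrix (Fin ℓ) (Fin m) 𝕜 → Quintuple 𝕜 ℓ n m :=
    fun u => (u.1, u.2.1, u.2.2.1, u.2.2.2.1 * u.1, u.2.2.2.2)
  have hC : Convex ℝ C :=
    convex_univ.prod (convex_skewHermitian.prod (h𝓡.prod (convex_posSemidef.prod convex_univ)))
  have hΦ : IsPolyMap Φ :=
    .prodMk .fst (.prodMk (.of_isLinearMap ⟨fun _ _ => rfl, fun _ _ => rfl⟩)
      (.prodMk (.of_isLinearMap ⟨fun _ _ => rfl, fun _ _ => rfl⟩)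
      (.prodMk (.matrixMul (.of_isLinearMap ⟨fun _ _ => rfl, fun _ _ => rfl⟩) .fst)
        (.of_isLinearMap ⟨fun _ _ => rfl, fun _ _ => rfl⟩))))
  have hcert : IsPolyMap fun v : Quintuple 𝕜 ℓ n m =>
      N v.1 ((v.2.1 - v.2.2.1) * v.2.2.2.1) v.2.2.2.2 :=
    (IsPolyMap.of_isLinearMap hN).comp (.prodMk .fst (.prodMk
      (.matrixMul
        (.of_isLinearMap ⟨fun _ _ => add_sub_add_comm _ _ _ _, fun _ _ => (smul_sub _ _ _).symm⟩)
        (.of_isLinearMap ⟨fun _ _ => rfl, fun _ _ => rfl⟩))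
      (.of_isLinearMap ⟨fun _ _ => rfl, fun _ _ => rfl⟩)))
  refine .of_convex_image (u := (E₁, J₁, 0, 1, B₁)) hC hΦ ?_ ?_
    (hcert.comp_mem_polyFun gramDet_mem_polyFun) (fun v _ h => hP _ _ _ (gramDet_ne_zero_iff.1 h))
    ?_ ?_
  · rintro ⟨E, J, R, K, B⟩ ⟨-, hJ, hR, hK, -⟩
    exact ⟨hJ, hR, conjTranspose_mul_mul_comm_and_posSemidef hK E⟩
  · rintro ⟨E, J, R, Q, B⟩ ⟨hJ, hR, -, hEQ⟩
    refine map_mem_closure (f := fun p : _ × _ => (p.1, J, R, p.2, B)) (by fun_prop)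
      (mem_closure_image_mul_posSemidef hEQ) ?_
    rintro ⟨F, _⟩ ⟨K, hK, rfl⟩
    exact ⟨(F, J, R, K, B), ⟨trivial, hJ, hR, hK, trivial⟩, rfl⟩
  · exact map_mem_closure (f := fun R => (E₁, J₁, R, 1, B₁)) (by fun_prop) h0
      fun R hR => ⟨trivial, hJ₁, hR, PosSemidef.one, trivial⟩
  · simpa only [Φ, Matrix.one_mul, sub_zero] using gramDet_ne_zero_iff.2 h₁

theorem GenericOnSigma.of_injective
    (hN : IsLinearMap ℝ fun w : _ × _ × _ => N w.1 w.2.1 w.2.2)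
    (hP : ∀ E A B, Function.Injective (N E A B).mulVec → P E A B)
    (hJ₁ : J₁ = -J₁ᴴ) (h₁ : Function.Injective (N E₁ (J₁ * E₁) B₁).mulVec) :
    GenericOnSigma P := by
  refine ⟨isRelGeneric_sigmaH_of_injective hN hP hJ₁ h₁, ?_⟩
  have hherm {R : Matrix (Fin ℓ) (Fin ℓ) 𝕜} (hR : R.IsHermitian) : R = Rᴴ := hR.eq.symm
  rintro V (rfl | rfl)
  · have h := isRelGeneric_dissipative_of_injective convex_posSemidef
      (subset_closure PosSemidef.zero) hN hP hJ₁ h₁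
    simpa [SigmaSdH, and_iff_right_of_imp fun h => hherm (PosSemidef.isHermitian h)] using h
  · have h := isRelGeneric_dissipative_of_injective convex_posDef zero_mem_closure_posDef
      hN hP hJ₁ h₁
    simpa [SigmaDH, and_iff_right_of_imp fun h => hherm (PosDef.isHermitian h)] using h

end GenericOnSigma

section FullRank

open Matrix

variable {F ι κ : Type*} [Field F] [Fintype κ]

theorem mulVec_injective_iff_forall_eq_zero {M : Matrix ι κ F} :
    Function.Injective M.mulVec ↔ ∀ x, M *ᵥ x = 0 → x = 0 :=
  injective_iff_map_eq_zero M.mulVecLin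

theorem mulVec_injective_iff_rank_eq_card {M : Matrix ι κ F} :
    Function.Injective M.mulVec ↔ M.rank = Fintype.card κ := by
  rw [mulVec_injective_iff, linearIndependent_iff_card_eq_finrank_span, rank_eq_finrank_span_cols,
    Set.finrank, eq_comm]

/-- A matrix has full rank if its rank is the smaller one of its two dimensions. The rank
conditions of the theorem are instances of this notion. -/
def HasFullRank [Fintype ι] (M : Matrix ι κ F) : Prop :=
  M.rank = min (Fintype.card ι) (Fintype.card κ)

theorem hasFullRank_iff_mulVec_injective [Fintype ι] {M : Matrix ι κ F} :
    HasFullRank M ↔ Function.Injective M.mulVec ∨ Function.Injective Mᵀ.mulVec := by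
  rw [mulVec_injective_iff_rank_eq_card, mulVec_injective_iff_rank_eq_card, rank_transpose,
    HasFullRank]
  have hheight := M.rank_le_card_height
  have hwidth := M.rank_le_card_width
  omega

theorem exists_mul_eq_one_of_mulVec_injective [Fintype ι] [DecidableEq κ] {M : Matrix ι κ F}
    (h : Function.Injective M.mulVec) : ∃ N : Matrix κ ι F, N * M = 1 := by
  classical
  obtain ⟨g, hg⟩ := M.mulVecLin.exists_leftInverse_of_injective (LinearMap.ker_eq_bot.2 h)
  refine ⟨LinearMap.toMatrix' g, ?_⟩
  rw [← LinearMap.toMatrix'_id, ← hg, LinearMap.toMatrix'_comp, ← toLin'_apply',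
    LinearMap.toMatrix'_toLin']

/-- `φ` is to be thought of as the specialization of a parameter and `ψ` as the passage to the
generic value of that parameter. -/
theorem mulVec_injective_map_of_specialization [Finite ι] {R F' : Type*} [CommRing R] [Field F']
    {φ : R →+* F} (hφ : Function.Surjective φ) {ψ : R →+* F'} (hψ : Function.Injective ψ)
    {M : Matrix ι κ R} (h : Function.Injective (M.map φ).mulVec) :
    Function.Injective (M.map ψ).mulVec := by
  classical
  have := Fintype.ofFinite ι
  obtain ⟨N₀, hN₀⟩ := exists_mul_eq_one_of_mulVec_injective h
  obtain ⟨N, rfl⟩ : ∃ N : Matrix κ ι R, N.map φ = N₀ :=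
    ⟨N₀.map (Function.surjInv hφ), by ext; exact Function.surjInv_eq hφ _⟩
  have hdet : (N * M).det ≠ 0 := by
    intro h0
    have h1 := φ.map_det (N * M)
    rw [RingHom.mapMatrix_apply, Matrix.map_mul, hN₀, h0, map_zero, det_one] at h1
    exact zero_ne_one h1
  have hdet' : (N.map ψ * M.map ψ).det ≠ 0 := by
    rw [← Matrix.map_mul, ← RingHom.mapMatrix_apply, ← RingHom.map_det]
    exact (map_ne_zero_iff ψ hψ).2 hdet
  refine Function.Injective.of_comp (f := (N.map ψ).mulVec) ?_
  simpa only [Function.comp_def, mulVec_mulVec] using mulVec_injective_of_det_ne_zero hdet'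

end FullRank

section UnitCols

open Matrix

variable {F : Type*} [Field F] {ℓ : ℕ} {ι κ : Type*} {g : κ → ℕ}

variable (F ℓ g) in
/-- The matrix whose column `c` is the unit vector with index `g c`, or zero if `ℓ ≤ g c`. All
the witnesses `E` and `B` of genericity are of this form. -/
def unitCols : Matrix (Fin ℓ) κ F :=
  of fun i c => if (i : ℕ) = g c then 1 else 0

theorem unitCols_transpose_mulVec_apply {c : κ} {i : Fin ℓ} (hc : g c = i) (v : Fin ℓ → F) :
    ((unitCols F ℓ g)ᵀ *ᵥ v) c = v i := by
  simp [unitCols, mulVec, dotProduct, hc, Fin.val_inj]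

theorem unitCols_transpose_mulVec_injective (hg : ∀ i < ℓ, ∃ c, g c = i) :
    Function.Injective (unitCols F ℓ g)ᵀ.mulVec := fun v w hvw => funext fun i => by
  obtain ⟨c, hc⟩ := hg i i.2
  rw [← unitCols_transpose_mulVec_apply hc v, hvw, unitCols_transpose_mulVec_apply hc]

theorem mul_unitCols_apply (M : Matrix ι (Fin ℓ) F) {c : κ} {j : Fin ℓ} (hc : g c = j) (i : ι) :
    (M * unitCols F ℓ g) i c = M i j := by
  simp [unitCols, mul_apply, hc, Fin.val_inj]

theorem fromCols_unitCols {κ' : Type*} (g' : κ' → ℕ) :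
    fromCols (unitCols F ℓ g) (unitCols F ℓ g') = unitCols F ℓ (Sum.elim g g') := by
  ext i (c | c) <;> rfl

variable [Fintype κ]

theorem unitCols_mulVec_apply (hg : Function.Injective g) {c : κ} {i : Fin ℓ} (hc : g c = i)
    (x : κ → F) : (unitCols F ℓ g *ᵥ x) i = x c := by
  classical
  simp [unitCols, mulVec, dotProduct, ← hc, hg.eq_iff]

theorem unitCols_mulVec_apply_eq_zero {i : Fin ℓ} (hi : ∀ c, g c ≠ i) (x : κ → F) :
    (unitCols F ℓ g *ᵥ x) i = 0 := by
  simp [unitCols, mulVec, dotProduct, (hi _).symm]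

theorem unitCols_mulVec_injective (hg : Function.Injective g) (hlt : ∀ c, g c < ℓ) :
    Function.Injective (unitCols F ℓ g).mulVec := fun x y hxy => funext fun c => by
  rw [← unitCols_mulVec_apply (ℓ := ℓ) (i := ⟨g c, hlt c⟩) hg rfl x, hxy,
    unitCols_mulVec_apply hg rfl]

theorem hasFullRank_unitCols (hg : Function.Injective g) (hlt : ∀ c, g c < Fintype.card κ) :
    HasFullRank (unitCols F ℓ g) := by
  rw [hasFullRank_iff_mulVec_injective]
  rcases le_total (Fintype.card κ) ℓ with h | h
  · exact .inl (unitCols_mulVec_injective hg fun c => (hlt c).trans_le h)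
  · have hbij : Function.Bijective fun c => (⟨g c, hlt c⟩ : Fin (Fintype.card κ)) :=
      (Fintype.bijective_iff_injective_and_card _).2
        ⟨fun a b hab => hg (Fin.ext_iff.1 hab), (Fintype.card_fin _).symm⟩
    refine .inr (unitCols_transpose_mulVec_injective fun i hi => ?_)
    obtain ⟨c, hc⟩ := hbij.2 ⟨i, hi.trans_le h⟩
    exact ⟨c, Fin.ext_iff.1 hc⟩

theorem hasFullRank_fromCols_unitCols (n m : ℕ) :
    HasFullRank (fromCols (unitCols F ℓ fun c : Fin n => (c : ℕ))
      (unitCols F ℓ fun c : Fin m => n + c)) := by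
  rw [fromCols_unitCols]
  refine hasFullRank_unitCols (Fin.val_injective.sumElim (fun a b h => by lia) fun a b => by lia) ?_
  simp only [Sum.forall, Sum.elim_inl, Sum.elim_inr, Fintype.card_sum, Fintype.card_fin]
  exact ⟨fun c => by omega, fun c => by omega⟩

theorem hasFullRank_fromCols_fromCols_unitCols (n m : ℕ) :
    HasFullRank (fromCols (unitCols F ℓ fun c : Fin n => (c : ℕ))
      (fromCols (unitCols F ℓ fun c : Fin n => n + c)
        (unitCols F ℓ fun c : Fin m => 2 * n + c))) := by
  rw [fromCols_unitCols, fromCols_unitCols]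
  have hdisj (a : Fin n) : ∀ b : Fin n ⊕ Fin m,
      (a : ℕ) ≠ Sum.elim (fun c : Fin n => n + c) (fun c : Fin m => 2 * n + c) b := by
    simp only [Sum.forall, Sum.elim_inl, Sum.elim_inr]
    exact ⟨fun c => by omega, fun c => by omega⟩
  refine hasFullRank_unitCols (Fin.val_injective.sumElim
    (.sumElim (fun a b h => by lia) (fun a b h => by lia) fun a b => by lia) hdisj) ?_
  simp only [Sum.forall, Sum.elim_inl, Sum.elim_inr, Fintype.card_sum, Fintype.card_fin]
  exact ⟨fun c => by omega, fun c => by omega, fun c => by omega⟩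

end UnitCols

section Constant

open Matrix

variable {𝕜 : Type*} [RCLike 𝕜] {ℓ n m : ℕ}

theorem isLinearMap_fromCols {V ι κ κ' : Type*} [AddCommGroup V] [Module ℝ V]
    {f : V → Matrix ι κ 𝕜} {g : V → Matrix ι κ' 𝕜} (hf : IsLinearMap ℝ f) (hg : IsLinearMap ℝ g) :
    IsLinearMap ℝ fun v => fromCols (f v) (g v) where
  map_add v w := by ext i (j | j) <;> simp [hf.map_add, hg.map_add]
  map_smul c v := by ext i (j | j) <;> simp [hf.map_smul, hg.map_smul]

theorem eq_neg_conjTranspose_of_ite {κ : Type*} (r : κ → κ → Prop) [DecidableRel r] :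
    (of fun i j => (if r i j then 1 else 0) - if r j i then 1 else 0 : Matrix κ κ 𝕜) =
      -(of fun i j => (if r i j then 1 else 0) - if r j i then 1 else 0)ᴴ := by
  ext i j
  simp only [of_apply, Matrix.neg_apply, conjTranspose_apply, star_sub, apply_ite star, star_one,
    star_zero, neg_sub]

theorem GenericOnSigma.of_hasFullRank {𝕜' ι κ : Type*} [RCLike 𝕜'] [Fintype ι] [Fintype κ]
    {P : Matrix (Fin ℓ) (Fin n) 𝕜 → Matrix (Fin ℓ) (Fin n) 𝕜 → Matrix (Fin ℓ) (Fin m) 𝕜 → Prop}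
    {N : Matrix (Fin ℓ) (Fin n) 𝕜 → Matrix (Fin ℓ) (Fin n) 𝕜 → Matrix (Fin ℓ) (Fin m) 𝕜 →
      Matrix ι κ 𝕜'}
    (hN : IsLinearMap ℝ fun w : _ × _ × _ => N w.1 w.2.1 w.2.2)
    (hP : ∀ E A B, HasFullRank (N E A B) → P E A B)
    {E₁ : Matrix (Fin ℓ) (Fin n) 𝕜} {J₁ : Matrix (Fin ℓ) (Fin ℓ) 𝕜} {B₁ : Matrix (Fin ℓ) (Fin m) 𝕜}
    (hJ₁ : J₁ = -J₁ᴴ) (h₁ : HasFullRank (N E₁ (J₁ * E₁) B₁)) : GenericOnSigma P := by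
  simp only [hasFullRank_iff_mulVec_injective] at hP h₁
  rcases h₁ with h₁ | h₁
  · exact .of_injective hN (fun E A B h => hP E A B (.inl h)) hJ₁ h₁
  · exact .of_injective (N := fun E A B => (N E A B)ᵀ)
      ⟨fun v w => congrArg transpose (hN.map_add v w),
        fun c v => congrArg transpose (hN.map_smul c v)⟩
      (fun E A B h => hP E A B (.inr h)) hJ₁ h₁

theorem fullRankEB_iff_hasFullRank {E : Matrix (Fin ℓ) (Fin n) 𝕜} {B : Matrix (Fin ℓ) (Fin m) 𝕜} :
    FullRankEB E B ↔ HasFullRank (fromCols E B) := by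
  simp only [FullRankEB, HasFullRank, Fintype.card_sum, Fintype.card_fin]

theorem fullRankEAB_iff_hasFullRank {E A : Matrix (Fin ℓ) (Fin n) 𝕜}
    {B : Matrix (Fin ℓ) (Fin m) 𝕜} :
    FullRankEAB E A B ↔ HasFullRank (fromCols E (fromCols A B)) := by
  simp only [FullRankEAB, HasFullRank, Fintype.card_sum, Fintype.card_fin, two_mul, add_assoc]

theorem fullRankKernel_of_fullRankEB {E A : Matrix (Fin ℓ) (Fin n) 𝕜}
    {B : Matrix (Fin ℓ) (Fin m) 𝕜} (h : FullRankEB E B) : FullRankKernel E A B := by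
  intro Z _
  have hlower : (fromCols E B).rank ≤ (fromCols E (fromCols (A * Z) B)).rank := by
    convert rank_submatrix_le (fromCols E (fromCols (A * Z) B)) id (Sum.map id Sum.inr)
    ext i (j | j) <;> rfl
  have hheight := (fromCols E (fromCols (A * Z) B)).rank_le_card_height
  have hwidth := (fromCols E (fromCols (A * Z) B)).rank_le_card_width
  have hE : (fromCols E B).rank = n + m → E.rank = n := by
    intro hEB
    have hinj := mulVec_injective_iff_rank_eq_card.2 (hEB.trans (by simp))
    rw [mulVec_injective_iff] at hinj
    have hcols : LinearIndependent 𝕜 E.col := hinj.comp Sum.inl Sum.inl_injective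
    rw [mulVec_injective_iff_rank_eq_card.1 (mulVec_injective_iff.2 hcols), Fintype.card_fin]
  simp only [Fintype.card_sum, Fintype.card_fin] at hheight hwidth
  rw [FullRankEB] at h
  omega

theorem fullRankPencil_of_hasFullRank {E A : Matrix (Fin ℓ) (Fin n) 𝕜}
    {B : Matrix (Fin ℓ) (Fin m) 𝕜} (h : HasFullRank (fromCols (E - A) B)) :
    FullRankPencil E A B := by
  let M : Matrix (Fin ℓ) (Fin n ⊕ Fin m) (Polynomial 𝕜) :=
    fromCols ((Polynomial.X : Polynomial 𝕜) • E.map Polynomial.C - A.map Polynomial.C)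
      (B.map Polynomial.C)
  have hspecial : fromCols (E - A) B = M.map (Polynomial.evalRingHom 1) := by
    ext i (j | j) <;> simp [M]
  have hgeneric : fromCols ((RatFunc.X : RatFunc 𝕜) • E.map RatFunc.C - A.map RatFunc.C)
      (B.map RatFunc.C) = M.map (algebraMap (Polynomial 𝕜) (RatFunc 𝕜)) := by
    ext i (j | j) <;> simp [M, mul_comm (RatFunc.C _)]
  have hφ : Function.Surjective (Polynomial.evalRingHom (1 : 𝕜)) := Polynomial.eval_surjective 1
  have hψ := RatFunc.algebraMap_injective 𝕜
  have hfull : HasFullRank (M.map (algebraMap (Polynomial 𝕜) (RatFunc 𝕜))) := by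
    rw [hspecial, hasFullRank_iff_mulVec_injective] at h
    rw [hasFullRank_iff_mulVec_injective]
    exact h.imp (mulVec_injective_map_of_specialization hφ hψ)
      (mulVec_injective_map_of_specialization (M := Mᵀ) hφ hψ)
  simpa only [FullRankPencil, hgeneric, HasFullRank, Fintype.card_sum, Fintype.card_fin] using hfull

theorem genericOnSigma_fullRankEB :
    GenericOnSigma fun (E : Matrix (Fin ℓ) (Fin n) 𝕜) (_ : Matrix (Fin ℓ) (Fin n) 𝕜)
      (B : Matrix (Fin ℓ) (Fin m) 𝕜) => FullRankEB E B :=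
  .of_hasFullRank (isLinearMap_fromCols ⟨fun _ _ => rfl, fun _ _ => rfl⟩
      ⟨fun _ _ => rfl, fun _ _ => rfl⟩)
    (fun _ _ _ => fullRankEB_iff_hasFullRank.2) (J₁ := 0) (by simp)
    (hasFullRank_fromCols_unitCols n m)

theorem genericOnSigma_fullRankEAB :
    GenericOnSigma (FullRankEAB : Matrix (Fin ℓ) (Fin n) 𝕜 → Matrix (Fin ℓ) (Fin n) 𝕜 →
      Matrix (Fin ℓ) (Fin m) 𝕜 → Prop) := by
  let J : Matrix (Fin ℓ) (Fin ℓ) 𝕜 :=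
    of fun i j => (if (i : ℕ) = n + j then 1 else 0) - if (j : ℕ) = n + i then 1 else 0
  have hJE : J * unitCols 𝕜 ℓ (fun c : Fin n => (c : ℕ)) = unitCols 𝕜 ℓ fun c : Fin n => n + c := by
    ext i c
    by_cases hc : (c : ℕ) < ℓ
    · have hne : (c : ℕ) ≠ n + i := by omega
      refine (mul_unitCols_apply J (c := c) (j := ⟨c, hc⟩) rfl i).trans ?_
      simp [J, unitCols, hne]
    · have hzero (k : Fin ℓ) : (k : ℕ) ≠ c := by omega
      have hne : (i : ℕ) ≠ n + c := by omega
      simp [unitCols, mul_apply, hzero, hne]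
  refine .of_hasFullRank (N := fun E A B => fromCols E (fromCols A B))
    (isLinearMap_fromCols ⟨fun _ _ => rfl, fun _ _ => rfl⟩
      (isLinearMap_fromCols ⟨fun _ _ => rfl, fun _ _ => rfl⟩ ⟨fun _ _ => rfl, fun _ _ => rfl⟩))
    (fun _ _ _ => fullRankEAB_iff_hasFullRank.2)
    (eq_neg_conjTranspose_of_ite fun i j : Fin ℓ => (i : ℕ) = n + j)
    (E₁ := unitCols 𝕜 ℓ fun c : Fin n => (c : ℕ))
    (B₁ := unitCols 𝕜 ℓ fun c : Fin m => 2 * n + c) ?_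
  rw [hJE]
  exact hasFullRank_fromCols_fromCols_unitCols n m

theorem genericOnSigma_fullRankPencil :
    GenericOnSigma (FullRankPencil : Matrix (Fin ℓ) (Fin n) 𝕜 → Matrix (Fin ℓ) (Fin n) 𝕜 →
      Matrix (Fin ℓ) (Fin m) 𝕜 → Prop) :=
  .of_hasFullRank (isLinearMap_fromCols
      ⟨fun _ _ => add_sub_add_comm _ _ _ _, fun _ _ => (smul_sub _ _ _).symm⟩
      ⟨fun _ _ => rfl, fun _ _ => rfl⟩)
    (fun _ _ _ => fullRankPencil_of_hasFullRank) (J₁ := 0) (by simp)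
    (by simpa using hasFullRank_fromCols_unitCols n m)

theorem genericOnSigma_fullRankKernel :
    GenericOnSigma (FullRankKernel : Matrix (Fin ℓ) (Fin n) 𝕜 → Matrix (Fin ℓ) (Fin n) 𝕜 →
      Matrix (Fin ℓ) (Fin m) 𝕜 → Prop) :=
  .of_hasFullRank (isLinearMap_fromCols ⟨fun _ _ => rfl, fun _ _ => rfl⟩
      ⟨fun _ _ => rfl, fun _ _ => rfl⟩)
    (fun _ _ _ h => fullRankKernel_of_fullRankEB (fullRankEB_iff_hasFullRank.2 h)) (J₁ := 0)
    (by simp) (hasFullRank_fromCols_unitCols n m)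

end Constant

section LinearPencil

variable {K X Z : Type*} [Field K] [IsAlgClosed K] [AddCommGroup X] [Module K X]
  [FiniteDimensional K X] [AddCommGroup Z] [Module K Z] {E A : X →ₗ[K] Z}

theorem exists_eigenvector_of_range_le [Nontrivial X] (hE : Function.Injective E)
    (hA : LinearMap.range A ≤ LinearMap.range E) : ∃ (z : K) (x : X), x ≠ 0 ∧ A x = z • E x := by
  obtain ⟨G, hG⟩ := E.exists_leftInverse_of_injective (LinearMap.ker_eq_bot.2 hE)
  obtain ⟨z, hz⟩ := Module.End.exists_eigenvalue (G ∘ₗ A)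
  obtain ⟨x, hx⟩ := hz.exists_hasEigenvector
  obtain ⟨w, hw⟩ := hA ⟨x, rfl⟩
  have hwx : w = z • x := by
    rw [← hx.apply_eq_smul, LinearMap.comp_apply, ← hw]
    exact (LinearMap.congr_fun hG w).symm
  exact ⟨z, x, hx.2, by rw [← hw, hwx, map_smul]⟩

theorem eq_bot_of_map_le_map (hE : Function.Injective E) (hz : ∀ (z : K) x, A x = z • E x → x = 0)
    {S : Submodule K X} (hS : S.map A ≤ S.map E) : S = ⊥ := by
  by_contra hne
  have := Submodule.nontrivial_iff_ne_bot.2 hne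
  obtain ⟨z, x, hx, hzx⟩ := exists_eigenvector_of_range_le (E := E ∘ₗ S.subtype)
    (A := A ∘ₗ S.subtype) (hE.comp S.subtype_injective)
    (by simpa only [LinearMap.range_comp, Submodule.range_subtype] using hS)
  exact hx (Subtype.ext (hz z x hzx))

/-- The heads `x₀` of chains of length `k` form a decreasing sequence of subspaces; it becomes
stationary at a subspace `S` with `A S ⊆ E S`. -/
theorem exists_forall_chain_eq_zero (hE : Function.Injective E)
    (hz : ∀ (z : K) x, A x = z • E x → x = 0) :
    ∃ k > 0, ∀ x : Fin (k + 1) → X, (∀ i : Fin k, E (x i.succ) = A (x i.castSucc)) → x = 0 := by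
  let f : Submodule K X → Submodule K X := fun S => (S.map E).comap A
  have hf : Monotone f := fun S T h => Submodule.comap_mono (Submodule.map_mono h)
  obtain ⟨k, hk⟩ := IsArtinian.monotone_stabilizes (R := K) (M := X)
    ⟨fun k => OrderDual.toDual (f^[k] ⊤), hf.antitone_iterate_of_map_le le_top⟩
  have hbot : f^[k + 1] ⊤ = ⊥ := by
    have hfix : f^[k] ⊤ = f (f^[k] ⊤) := by
      rw [← Function.iterate_succ_apply' f]
      exact hk (k + 1) (by omega)
    rw [Function.iterate_succ_apply', ← hfix]
    exact eq_bot_of_map_le_map hE hz (Submodule.map_le_iff_le_comap.2 hfix.le)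
  refine ⟨k + 1, by omega, fun x hx => ?_⟩
  have hmem (j : ℕ) : ∀ i : Fin (k + 2), (i : ℕ) + j = k + 1 → x i ∈ f^[j] ⊤ := by
    induction j with
    | zero => exact fun _ _ => trivial
    | succ j ih =>
      intro i hi
      obtain ⟨i, rfl⟩ : ∃ i' : Fin (k + 1), i'.castSucc = i := ⟨⟨i, by omega⟩, rfl⟩
      rw [Fin.val_castSucc] at hi
      rw [Function.iterate_succ_apply']
      exact ⟨x i.succ, ih _ (by rw [Fin.val_succ]; omega), hx i⟩
  funext i
  induction i using Fin.induction with
  | zero => simpa [hbot] using hmem (k + 1) 0 (by simp)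
  | succ i ih => exact hE (by rw [hx, ih, Pi.zero_apply, map_zero, Pi.zero_apply, map_zero])

end LinearPencil

section Blocks

open Matrix

variable {K ι κ μ : Type*} [Field K]

theorem fromCols_mulVec_injective_iff [Fintype κ] [Fintype μ] {M : Matrix ι κ K}
    {B : Matrix ι μ K} :
    Function.Injective (fromCols M B).mulVec ↔ Function.Injective B.mulVec ∧
      Function.Injective (B.mulVecLin.range.mkQ ∘ₗ M.mulVecLin) := by
  simp only [mulVec_injective_iff_forall_eq_zero, injective_iff_map_eq_zero, fromCols_mulVec]
  constructor
  · refine fun h => ⟨fun y hy => ?_, fun x hx => ?_⟩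
    · have := h (Sum.elim 0 y) (by simpa using hy)
      exact funext fun j => congrFun this (.inr j)
    · obtain ⟨y, hy⟩ := (Submodule.Quotient.mk_eq_zero _).1 hx
      have := h (Sum.elim x (-y)) (by
        simpa [mulVec_neg, sub_eq_zero, ← sub_eq_add_neg] using hy.symm)
      exact funext fun j => congrFun this (.inl j)
  · intro ⟨hB, hM⟩ w hw
    have hx : w ∘ Sum.inl = 0 := hM _ ((Submodule.Quotient.mk_eq_zero _).2
      ⟨-(w ∘ Sum.inr), by simpa [mulVec_neg] using (eq_neg_of_add_eq_zero_left hw).symm⟩)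
    have hy : w ∘ Sum.inr = 0 := hB _ (by simpa [hx] using hw)
    ext (j | j)
    · exact congrFun hx j
    · exact congrFun hy j

theorem fromCols_transpose_mulVec_injective_iff [Fintype ι] {M : Matrix ι κ K} {B : Matrix ι μ K} :
    Function.Injective (fromCols M B)ᵀ.mulVec ↔
      Function.Injective (Mᵀ.mulVecLin.domRestrict Bᵀ.mulVecLin.ker) := by
  simp only [mulVec_injective_iff_forall_eq_zero, injective_iff_map_eq_zero, transpose_fromCols,
    fromRows_mulVec, ← Sum.elim_zero_zero, Sum.elim_eq_iff]
  exact ⟨fun h v hv => Subtype.ext (h v ⟨hv, v.2⟩),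
    fun h v hv => congrArg Subtype.val (h ⟨v, hv.2⟩ hv.1)⟩

end Blocks

section Chains

open Matrix
open scoped Kronecker

variable {K ι κ μ : Type*} [Field K] {k : ℕ}

/-- The matrix of `(x₀, …, x_k) ↦ (E x_{i+1} - A x_i)_{i < k}`. -/
def shiftPencil (k : ℕ) (E A : Matrix ι κ K) : Matrix (Fin k × ι) (Fin (k + 1) × κ) K :=
  of fun p q => (if q.1 = p.1.succ then E p.2 q.2 else 0) -
    if q.1 = p.1.castSucc then A p.2 q.2 else 0

/-- The matrix of `(x₀, …, x_k, y₀, …, y_{k-1}) ↦ (E x_{i+1} - A x_i + B y_i)_{i < k}`. Its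
injectivity is a certificate, polynomial in `E`, `A` and `B`, for the injectivity of
`[z E - A, B]` for all `z` at once. -/
def colChain (k : ℕ) (E A : Matrix ι κ K) (B : Matrix ι μ K) :
    Matrix (Fin k × ι) ((Fin (k + 1) × κ) ⊕ (Fin k × μ)) K :=
  fromCols (shiftPencil k E A) (1 ⊗ₖ B)

/-- The matrix of `(v₀, …, v_k) ↦ (v_{i+1} E - v_i A, v_i B)` for row vectors `v_i`, the
analogue of `colChain` for the injectivity of the transpose of `[z E - A, B]`. -/
def rowChain (k : ℕ) (E A : Matrix ι κ K) (B : Matrix ι μ K) :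
    Matrix ((Fin k × κ) ⊕ (Fin (k + 1) × μ)) (Fin (k + 1) × ι) K :=
  fromRows (shiftPencil k Eᵀ Aᵀ) (1 ⊗ₖ Bᵀ)

theorem shiftPencil_mulVec_apply [Fintype κ] (E A : Matrix ι κ K) (x : Fin (k + 1) × κ → K)
    (i : Fin k) (r : ι) : (shiftPencil k E A *ᵥ x) (i, r) =
      (E *ᵥ x.curry i.succ - A *ᵥ x.curry i.castSucc) r := by
  simp [shiftPencil, mulVec, dotProduct, Fintype.sum_prod_type, sub_mul, ite_mul]

theorem one_kronecker_mulVec_apply [Fintype κ] (M : Matrix ι κ K) (x : Fin k × κ → K) (i : Fin k)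
    (r : ι) : ((1 : Matrix (Fin k) (Fin k) K) ⊗ₖ M *ᵥ x) (i, r) = (M *ᵥ x.curry i) r := by
  simp [mulVec, dotProduct, Fintype.sum_prod_type, one_apply, ite_mul]

theorem colChain_mulVec_injective_iff [Fintype κ] [Fintype μ] {E A : Matrix ι κ K}
    {B : Matrix ι μ K} :
    Function.Injective (colChain k E A B).mulVec ↔
      ∀ (x : Fin (k + 1) → κ → K) (y : Fin k → μ → K),
        (∀ i : Fin k, E *ᵥ x i.succ - A *ᵥ x i.castSucc + B *ᵥ y i = 0) → x = 0 ∧ y = 0 := by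
  have hmul (w) : colChain k E A B *ᵥ w = 0 ↔ ∀ i : Fin k,
      E *ᵥ (w ∘ Sum.inl).curry i.succ - A *ᵥ (w ∘ Sum.inl).curry i.castSucc +
        B *ᵥ (w ∘ Sum.inr).curry i = 0 := by
    simp only [colChain, fromCols_mulVec, funext_iff, Prod.forall, Pi.add_apply,
      shiftPencil_mulVec_apply, one_kronecker_mulVec_apply, Pi.zero_apply]
  simp only [mulVec_injective_iff_forall_eq_zero, hmul]
  refine ⟨fun h x y hxy => ?_, fun h w hw => ?_⟩
  · have := h (Sum.elim x.uncurry y.uncurry) hxy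
    exact ⟨funext₂ fun i r => congrFun this (.inl (i, r)),
      funext₂ fun i r => congrFun this (.inr (i, r))⟩
  · obtain ⟨hx, hy⟩ := h _ _ hw
    ext (⟨i, r⟩ | ⟨i, r⟩)
    · exact congrFun₂ hx i r
    · exact congrFun₂ hy i r

theorem rowChain_mulVec_injective_iff [Fintype ι] {E A : Matrix ι κ K} {B : Matrix ι μ K} :
    Function.Injective (rowChain k E A B).mulVec ↔ ∀ v : Fin (k + 1) → ι → K,
      (∀ i : Fin k, Eᵀ *ᵥ v i.succ = Aᵀ *ᵥ v i.castSucc) → (∀ i, Bᵀ *ᵥ v i = 0) → v = 0 := by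
  have hmul (w) : rowChain k E A B *ᵥ w = 0 ↔
      (∀ i : Fin k, Eᵀ *ᵥ w.curry i.succ = Aᵀ *ᵥ w.curry i.castSucc) ∧
        ∀ i, Bᵀ *ᵥ w.curry i = 0 := by
    simp only [rowChain, fromRows_mulVec, funext_iff, Sum.forall, Prod.forall, Sum.elim_inl,
      Sum.elim_inr, shiftPencil_mulVec_apply, one_kronecker_mulVec_apply, Pi.sub_apply,
      Pi.zero_apply, sub_eq_zero]
  simp only [mulVec_injective_iff_forall_eq_zero, hmul]
  refine ⟨fun h v hE hB => ?_, fun h w hw => ?_⟩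
  · have := h v.uncurry ⟨hE, hB⟩
    exact funext₂ fun i r => congrFun this (i, r)
  · ext ⟨i, r⟩
    exact congrFun₂ (h _ hw.1 hw.2) i r

theorem pencil_mulVec_injective_of_colChain [Fintype κ] [Fintype μ] (hk : 0 < k)
    {E A : Matrix ι κ K} {B : Matrix ι μ K} (h : Function.Injective (colChain k E A B).mulVec)
    (z : K) : Function.Injective (fromCols (z • E - A) B).mulVec := by
  refine mulVec_injective_iff_forall_eq_zero.2 fun w hw => ?_
  rw [fromCols_mulVec, sub_mulVec, smul_mulVec] at hw
  obtain ⟨hx, hy⟩ := colChain_mulVec_injective_iff.1 h (fun i => z ^ (i : ℕ) • (w ∘ Sum.inl))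
    (fun i => z ^ (i : ℕ) • (w ∘ Sum.inr)) fun i => by
      simp only [mulVec_smul, Fin.val_succ, Fin.val_castSucc, pow_succ, mul_smul]
      rw [← smul_sub, ← smul_add, hw, smul_zero]
  ext (j | j)
  · simpa using congrFun₂ hx 0 j
  · simpa using congrFun₂ hy ⟨0, hk⟩ j

theorem pencil_transpose_mulVec_injective_of_rowChain [Fintype ι] {E A : Matrix ι κ K}
    {B : Matrix ι μ K} (h : Function.Injective (rowChain k E A B).mulVec) (z : K) :
    Function.Injective (fromCols (z • E - A) B)ᵀ.mulVec := by
  refine mulVec_injective_iff_forall_eq_zero.2 fun v hv => ?_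
  rw [transpose_fromCols, fromRows_mulVec, ← Sum.elim_zero_zero, Sum.elim_eq_iff, transpose_sub,
    transpose_smul, sub_mulVec, smul_mulVec, sub_eq_zero] at hv
  have := rowChain_mulVec_injective_iff.1 h (fun i => z ^ (i : ℕ) • v)
    (fun i => by
      simp only [mulVec_smul, ← hv.1, smul_smul, Fin.val_succ, Fin.val_castSucc, pow_succ])
    (fun i => by rw [mulVec_smul, hv.2, smul_zero])
  simpa using congrFun this 0

variable [IsAlgClosed K]

theorem exists_colChain_mulVec_injective [Fintype κ] [Fintype μ] {E A : Matrix ι κ K}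
    {B : Matrix ι μ K} (hE : Function.Injective (fromCols E B).mulVec)
    (hz : ∀ z : K, Function.Injective (fromCols (z • E - A) B).mulVec) :
    ∃ k > 0, Function.Injective (colChain k E A B).mulVec := by
  simp only [fromCols_mulVec_injective_iff] at hE hz
  obtain ⟨k, hk, h⟩ := exists_forall_chain_eq_zero hE.2 (A := B.mulVecLin.range.mkQ ∘ₗ A.mulVecLin)
    fun z x hx => (injective_iff_map_eq_zero _).1 (hz z).2 x (by
      simpa [sub_mulVec, smul_mulVec, sub_eq_zero] using hx.symm)
  refine ⟨k, hk, colChain_mulVec_injective_iff.2 fun x y hxy => ?_⟩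
  have hx : x = 0 := h x fun i => (Submodule.Quotient.eq _).2
    ⟨-y i, by simpa [mulVec_neg] using (eq_neg_of_add_eq_zero_left (hxy i)).symm⟩
  refine ⟨hx, funext fun i => mulVec_injective_iff_forall_eq_zero.1 hE.1 _ ?_⟩
  simpa [hx] using hxy i

theorem exists_rowChain_mulVec_injective [Fintype ι] {E A : Matrix ι κ K} {B : Matrix ι μ K}
    (hE : Function.Injective (fromCols E B)ᵀ.mulVec)
    (hz : ∀ z : K, Function.Injective (fromCols (z • E - A) B)ᵀ.mulVec) :
    ∃ k, Function.Injective (rowChain k E A B).mulVec := by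
  simp only [fromCols_transpose_mulVec_injective_iff] at hE hz
  obtain ⟨k, -, h⟩ := exists_forall_chain_eq_zero hE (A := Aᵀ.mulVecLin.domRestrict _)
    fun z v hv => (injective_iff_map_eq_zero _).1 (hz z) v (by
      simpa [sub_mulVec, smul_mulVec, sub_eq_zero] using hv.symm)
  refine ⟨k, rowChain_mulVec_injective_iff.2 fun v hE hB => ?_⟩
  have := h (fun i => ⟨v i, hB i⟩) hE
  exact funext fun i => congrArg Subtype.val (congrFun this i)

end Chains

section Hessenberg

open Matrix

variable {F : Type*} [Field F] {κ : Type*} {ℓ n : ℕ}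

theorem eq_zero_of_hessenberg_mulVec_eq_smul {T : Matrix (Fin ℓ) (Fin ℓ) F}
    (hsuper : ∀ i j : Fin ℓ, (j : ℕ) = i + 1 → T i j ≠ 0)
    (hzero : ∀ i j : Fin ℓ, (i : ℕ) + 1 < j → T i j = 0) {z : F} {v : Fin ℓ → F} {p : ℕ}
    (hv : ∀ i : Fin ℓ, (i : ℕ) < p → (T *ᵥ v) i = z * v i)
    (h0 : ∀ i : Fin ℓ, (i : ℕ) = 0 → v i = 0)
    (i : Fin ℓ) (hi : (i : ℕ) ≤ p) : v i = 0 := by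
  obtain ⟨i, hiℓ⟩ := i
  induction i using Nat.strong_induction_on with
  | _ i ih =>
    rcases i with - | j
    · exact h0 _ rfl
    have hj : j < ℓ := by omega
    have hrow : (T *ᵥ v) ⟨j, hj⟩ = T ⟨j, hj⟩ ⟨j + 1, hiℓ⟩ * v ⟨j + 1, hiℓ⟩ := by
      refine Fintype.sum_eq_single (⟨j + 1, hiℓ⟩ : Fin ℓ) fun c hc => ?_
      rcases lt_or_gt_of_ne (Fin.val_ne_iff.2 hc) with hlt | hgt
      · rw [ih c hlt c.2 (hlt.le.trans hi), mul_zero]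
      · change T ⟨j, hj⟩ c * v c = 0
        rw [hzero ⟨j, hj⟩ c hgt, zero_mul]
    rw [hv _ (Nat.lt_of_succ_le hi), ih j j.lt_succ_self hj ((Nat.le_succ j).trans hi),
      mul_zero] at hrow
    exact (mul_eq_zero.1 hrow.symm).resolve_left (hsuper _ _ rfl)

variable (F ℓ) in
/-- The tridiagonal skew-symmetric matrix with entries `1` above the diagonal, the witness `J`
for the genericity of the pointwise rank condition. -/
def tridiagonal : Matrix (Fin ℓ) (Fin ℓ) F :=
  of fun i j => (if (i : ℕ) + 1 = j then 1 else 0) - if (j : ℕ) + 1 = i then 1 else 0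

theorem tridiagonal_transpose : (tridiagonal F ℓ)ᵀ = -tridiagonal F ℓ := by
  ext i j
  simp [tridiagonal]

theorem eq_zero_of_tridiagonal_mulVec_eq_smul {z : F} {v : Fin ℓ → F} {p : ℕ}
    (hv : ∀ i : Fin ℓ, (i : ℕ) < p → (tridiagonal F ℓ *ᵥ v) i = z * v i)
    (h0 : ∀ i : Fin ℓ, (i : ℕ) = 0 → v i = 0) (i : Fin ℓ) (hi : (i : ℕ) ≤ p) : v i = 0 := by
  refine eq_zero_of_hessenberg_mulVec_eq_smul (fun i j hij => ?_) (fun i j hij => ?_) hv h0 i hi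
  · have hne : (j : ℕ) + 1 ≠ i := by omega
    simp [tridiagonal, hij.symm, hne]
  · have hne₁ : (i : ℕ) + 1 ≠ j := by omega
    have hne₂ : (j : ℕ) + 1 ≠ i := by omega
    simp [tridiagonal, hne₁, hne₂]

theorem tridiagonal_pencil_mulVec_injective [Fintype κ] {g : κ → ℕ} (hg : Function.Injective g)
    (hgt : ∀ c, n < g c) (hlt : ∀ c, g c < ℓ) (hn : n < ℓ) (z : F) :
    Function.Injective (fromCols (z • unitCols F ℓ (fun c : Fin n => c + 1) -
      tridiagonal F ℓ * unitCols F ℓ fun c : Fin n => c + 1) (unitCols F ℓ g)).mulVec := by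
  refine mulVec_injective_iff_forall_eq_zero.2 fun w hw => ?_
  rw [fromCols_mulVec, sub_mulVec, smul_mulVec, ← mulVec_mulVec] at hw
  set v := unitCols F ℓ (fun c : Fin n => (c : ℕ) + 1) *ᵥ (w ∘ Sum.inl) with hv
  have hv0 := eq_zero_of_tridiagonal_mulVec_eq_smul (z := z) (v := v) (p := n + 1)
    (fun i hi => by
      have hrow := congrFun hw i
      rw [Pi.add_apply, unitCols_mulVec_apply_eq_zero fun c => by have := hgt c; omega, add_zero,
        Pi.sub_apply, Pi.smul_apply, Pi.zero_apply, sub_eq_zero] at hrow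
      exact hrow.symm)
    (fun i hi => unitCols_mulVec_apply_eq_zero (fun c => by omega) _)
  have hx : w ∘ Sum.inl = 0 := funext fun c => by
    have hc : (c : ℕ) + 1 < ℓ := by omega
    exact (unitCols_mulVec_apply (fun a b hab => Fin.ext (Nat.succ_injective hab))
      (i := ⟨c + 1, hc⟩) rfl _).symm.trans (hv0 _ (by simp))
  have hy : w ∘ Sum.inr = 0 := by
    refine mulVec_injective_iff_forall_eq_zero.1 (unitCols_mulVec_injective (F := F) hg hlt) _ ?_
    simpa [hv, hx] using hw
  ext (c | c)
  · exact congrFun hx c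
  · exact congrFun hy c

theorem tridiagonal_pencil_transpose_mulVec_injective {g : κ → ℕ}
    (hg : ∀ i < ℓ, i = 0 ∨ n ≤ i → ∃ c, g c = i) (z : F) :
    Function.Injective (fromCols (z • unitCols F ℓ (fun c : Fin n => (c : ℕ)) -
      tridiagonal F ℓ * unitCols F ℓ fun c : Fin n => (c : ℕ)) (unitCols F ℓ g))ᵀ.mulVec := by
  refine mulVec_injective_iff_forall_eq_zero.2 fun v hv => ?_
  rw [transpose_fromCols, fromRows_mulVec, ← Sum.elim_zero_zero, Sum.elim_eq_iff, transpose_sub,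
    transpose_smul, transpose_mul, tridiagonal_transpose, Matrix.mul_neg, sub_neg_eq_add,
    add_mulVec, smul_mulVec, ← mulVec_mulVec] at hv
  have hB (i : Fin ℓ) (hi : (i : ℕ) = 0 ∨ n ≤ i) : v i = 0 := by
    obtain ⟨c, hc⟩ := hg i i.2 hi
    rw [← unitCols_transpose_mulVec_apply hc v, hv.2, Pi.zero_apply]
  have hrow (i : Fin ℓ) (hi : (i : ℕ) < n) : (tridiagonal F ℓ *ᵥ v) i = -z * v i := by
    have hE (u : Fin ℓ → F) : ((unitCols F ℓ fun c : Fin n => (c : ℕ))ᵀ *ᵥ u) ⟨i, hi⟩ = u i :=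
      unitCols_transpose_mulVec_apply rfl u
    have := congrFun hv.1 ⟨i, hi⟩
    rw [Pi.add_apply, Pi.smul_apply, hE, hE, Pi.zero_apply] at this
    rw [eq_neg_of_add_eq_zero_right this, neg_mul, smul_eq_mul]
  have hv0 := eq_zero_of_tridiagonal_mulVec_eq_smul hrow fun i hi => hB i (.inl hi)
  exact funext fun i => (le_total (i : ℕ) n).elim (hv0 i) fun hi => hB i (.inr hi)

end Hessenberg

section Pointwise

open Matrix

variable {𝕜 : Type*} [RCLike 𝕜] {ℓ n m : ℕ}

theorem unitCols_map {κ : Type*} (g : κ → ℕ) :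
    (unitCols 𝕜 ℓ g).map (RCLike.map 𝕜 ℂ) = unitCols ℂ ℓ g := by
  ext i c
  simp [unitCols, apply_ite (RCLike.map 𝕜 ℂ)]

theorem tridiagonal_mul_unitCols_map {κ : Type*} (g : κ → ℕ) :
    (tridiagonal 𝕜 ℓ * unitCols 𝕜 ℓ g).map (RCLike.map 𝕜 ℂ) =
      tridiagonal ℂ ℓ * unitCols ℂ ℓ g := by
  ext i c
  simp only [tridiagonal, unitCols, mul_apply, map_apply, of_apply, mul_ite, mul_one, mul_zero,
    map_sum, map_sub, apply_ite (RCLike.map 𝕜 ℂ), map_zero]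
  simp

theorem fullRankPointwise_iff_hasFullRank {E A : Matrix (Fin ℓ) (Fin n) 𝕜}
    {B : Matrix (Fin ℓ) (Fin m) 𝕜} : FullRankPointwise E A B ↔
      ∀ z : ℂ, HasFullRank (fromCols (z • E.map (RCLike.map 𝕜 ℂ) - A.map (RCLike.map 𝕜 ℂ))
        (B.map (RCLike.map 𝕜 ℂ))) := by
  simp only [FullRankPointwise, HasFullRank, Fintype.card_sum, Fintype.card_fin]

section IsLinearMap

open scoped Kronecker

variable {V ι κ μ : Type*} [AddCommGroup V] [Module ℝ V] {E A : V → Matrix ι κ 𝕜}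
  {B : V → Matrix ι μ 𝕜} {k : ℕ}

theorem isLinearMap_map (hE : IsLinearMap ℝ E) :
    IsLinearMap ℝ fun v => (E v).map (RCLike.map 𝕜 ℂ) where
  map_add v w := by rw [hE.map_add]; exact Matrix.map_add _ (map_add _) _ _
  map_smul c v := by rw [hE.map_smul]; exact Matrix.map_smul _ _ (map_smul _ c) _

theorem isLinearMap_transpose (hE : IsLinearMap ℝ E) : IsLinearMap ℝ fun v => (E v)ᵀ where
  map_add v w := by rw [hE.map_add, transpose_add]
  map_smul c v := by rw [hE.map_smul, transpose_smul]

theorem isLinearMap_shiftPencil (hE : IsLinearMap ℝ E) (hA : IsLinearMap ℝ A) :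
    IsLinearMap ℝ fun v => shiftPencil k (E v) (A v) where
  map_add v w := by
    ext p q
    simp only [shiftPencil, of_apply, Matrix.add_apply, hE.map_add, hA.map_add]
    split_ifs <;> ring
  map_smul c v := by
    ext p q
    simp only [shiftPencil, of_apply, Matrix.smul_apply, hE.map_smul, hA.map_smul, smul_sub,
      smul_ite, smul_zero]

theorem isLinearMap_one_kronecker (hB : IsLinearMap ℝ B) :
    IsLinearMap ℝ fun v => (1 : Matrix (Fin k) (Fin k) 𝕜) ⊗ₖ B v where
  map_add v w := by rw [hB.map_add, kronecker_add]
  map_smul c v := by rw [hB.map_smul, kronecker_smul]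

theorem isLinearMap_colChain (hE : IsLinearMap ℝ E) (hA : IsLinearMap ℝ A)
    (hB : IsLinearMap ℝ B) : IsLinearMap ℝ fun v => colChain k (E v) (A v) (B v) :=
  isLinearMap_fromCols (isLinearMap_shiftPencil hE hA) (isLinearMap_one_kronecker hB)

theorem isLinearMap_rowChain (hE : IsLinearMap ℝ E) (hA : IsLinearMap ℝ A)
    (hB : IsLinearMap ℝ B) : IsLinearMap ℝ fun v => rowChain k (E v) (A v) (B v) := by
  have h := isLinearMap_transpose (isLinearMap_fromCols (isLinearMap_transpose
    (isLinearMap_shiftPencil (k := k) (isLinearMap_transpose hE) (isLinearMap_transpose hA)))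
    (isLinearMap_transpose (isLinearMap_one_kronecker (k := k + 1) (isLinearMap_transpose hB))))
  simpa only [rowChain, transpose_fromCols, transpose_transpose] using h

end IsLinearMap

theorem GenericOnSigma.fullRankPointwise_of_injective {E₁ : Matrix (Fin ℓ) (Fin n) 𝕜}
    {J₁ : Matrix (Fin ℓ) (Fin ℓ) 𝕜} {B₁ : Matrix (Fin ℓ) (Fin m) 𝕜} (hJ₁ : J₁ = -J₁ᴴ)
    (hE : Function.Injective
      (fromCols (E₁.map (RCLike.map 𝕜 ℂ)) (B₁.map (RCLike.map 𝕜 ℂ))).mulVec)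
    (hz : ∀ z : ℂ, Function.Injective (fromCols (z • E₁.map (RCLike.map 𝕜 ℂ) -
      (J₁ * E₁).map (RCLike.map 𝕜 ℂ)) (B₁.map (RCLike.map 𝕜 ℂ))).mulVec) :
    GenericOnSigma (FullRankPointwise : Matrix (Fin ℓ) (Fin n) 𝕜 →
      Matrix (Fin ℓ) (Fin n) 𝕜 → Matrix (Fin ℓ) (Fin m) 𝕜 → Prop) := by
  obtain ⟨k, hk, hchain⟩ := exists_colChain_mulVec_injective hE hz
  refine .of_injective (N := fun E A B => colChain k (E.map (RCLike.map 𝕜 ℂ))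
    (A.map (RCLike.map 𝕜 ℂ)) (B.map (RCLike.map 𝕜 ℂ)))
    (isLinearMap_colChain (isLinearMap_map ⟨fun _ _ => rfl, fun _ _ => rfl⟩)
      (isLinearMap_map ⟨fun _ _ => rfl, fun _ _ => rfl⟩)
      (isLinearMap_map ⟨fun _ _ => rfl, fun _ _ => rfl⟩)) (fun E A B h => ?_) hJ₁ hchain
  exact fullRankPointwise_iff_hasFullRank.2 fun z => hasFullRank_iff_mulVec_injective.2
      (.inl (pencil_mulVec_injective_of_colChain hk h z))

theorem GenericOnSigma.fullRankPointwise_of_transpose_injective {E₁ : Matrix (Fin ℓ) (Fin n) 𝕜}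
    {J₁ : Matrix (Fin ℓ) (Fin ℓ) 𝕜} {B₁ : Matrix (Fin ℓ) (Fin m) 𝕜} (hJ₁ : J₁ = -J₁ᴴ)
    (hE : Function.Injective
      (fromCols (E₁.map (RCLike.map 𝕜 ℂ)) (B₁.map (RCLike.map 𝕜 ℂ)))ᵀ.mulVec)
    (hz : ∀ z : ℂ, Function.Injective (fromCols (z • E₁.map (RCLike.map 𝕜 ℂ) -
      (J₁ * E₁).map (RCLike.map 𝕜 ℂ)) (B₁.map (RCLike.map 𝕜 ℂ)))ᵀ.mulVec) :
    GenericOnSigma (FullRankPointwise : Matrix (Fin ℓ) (Fin n) 𝕜 →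
      Matrix (Fin ℓ) (Fin n) 𝕜 → Matrix (Fin ℓ) (Fin m) 𝕜 → Prop) := by
  obtain ⟨k, hchain⟩ := exists_rowChain_mulVec_injective hE hz
  refine .of_injective (N := fun E A B => rowChain k (E.map (RCLike.map 𝕜 ℂ))
    (A.map (RCLike.map 𝕜 ℂ)) (B.map (RCLike.map 𝕜 ℂ)))
    (isLinearMap_rowChain (isLinearMap_map ⟨fun _ _ => rfl, fun _ _ => rfl⟩)
      (isLinearMap_map ⟨fun _ _ => rfl, fun _ _ => rfl⟩)
      (isLinearMap_map ⟨fun _ _ => rfl, fun _ _ => rfl⟩)) (fun E A B h => ?_) hJ₁ hchain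
  exact fullRankPointwise_iff_hasFullRank.2 fun z => hasFullRank_iff_mulVec_injective.2
      (.inr (pencil_transpose_mulVec_injective_of_rowChain h z))

theorem tridiagonal_eq_neg_conjTranspose : tridiagonal 𝕜 ℓ = -(tridiagonal 𝕜 ℓ)ᴴ :=
  eq_neg_conjTranspose_of_ite fun i j : Fin ℓ => (i : ℕ) + 1 = j

theorem genericOnSigma_fullRankPointwise (hm : 0 < m) (h : ℓ ≠ n + m) :
    GenericOnSigma (FullRankPointwise : Matrix (Fin ℓ) (Fin n) 𝕜 →
      Matrix (Fin ℓ) (Fin n) 𝕜 → Matrix (Fin ℓ) (Fin m) 𝕜 → Prop) := by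
  rcases lt_or_gt_of_ne h with hlt | hgt
  · have hcover (i : ℕ) (hi : i < ℓ) (hi' : i = 0 ∨ n ≤ i) :
        ∃ c : Fin m, (if (c : ℕ) = 0 then 0 else n + c - 1) = i := by
      rcases Nat.eq_zero_or_pos i with rfl | hpos
      · exact ⟨⟨0, hm⟩, rfl⟩
      · have hni : n ≤ i := hi'.resolve_left hpos.ne'
        exact ⟨⟨i - n + 1, by omega⟩, by simp; omega⟩
    refine .fullRankPointwise_of_transpose_injective (E₁ := unitCols 𝕜 ℓ fun c : Fin n => (c : ℕ))
      (B₁ := unitCols 𝕜 ℓ fun c : Fin m => if (c : ℕ) = 0 then 0 else n + c - 1)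
      tridiagonal_eq_neg_conjTranspose ?_ ?_ <;>
      simp only [tridiagonal_mul_unitCols_map, unitCols_map]
    · rw [fromCols_unitCols]
      refine unitCols_transpose_mulVec_injective fun i hi => ?_
      rcases lt_or_ge i n with hin | hin
      · exact ⟨.inl ⟨i, hin⟩, rfl⟩
      · obtain ⟨c, hc⟩ := hcover i hi (.inr hin)
        exact ⟨.inr c, hc⟩
    · exact tridiagonal_pencil_transpose_mulVec_injective hcover
  · refine .fullRankPointwise_of_injective (E₁ := unitCols 𝕜 ℓ fun c : Fin n => (c : ℕ) + 1)
      (B₁ := unitCols 𝕜 ℓ fun c : Fin m => n + 1 + c) tridiagonal_eq_neg_conjTranspose ?_ ?_ <;>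
      simp only [tridiagonal_mul_unitCols_map, unitCols_map]
    · rw [fromCols_unitCols]
      refine unitCols_mulVec_injective
        (.sumElim (fun a b hab => by lia) (fun a b hab => by lia) fun a b => by lia) ?_
      simp only [Sum.forall, Sum.elim_inl, Sum.elim_inr]
      exact ⟨fun c => by omega, fun c => by omega⟩
    · exact tridiagonal_pencil_mulVec_injective (fun a b hab => by simpa [Fin.val_inj] using hab)
        (fun c => by omega) (fun c => by omega) (by omega)

end Pointwise

section Square

open Matrix

theorem exists_pencil_mulVec_not_injective {K ι κ μ : Type*} [Field K] [IsAlgClosed K]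
    [Fintype κ] [Nonempty κ] [Fintype μ] {E A : Matrix ι κ K} {B : Matrix ι μ K}
    (hEB : Function.Bijective (fromCols E B).mulVec) :
    ∃ z : K, ¬ Function.Injective (fromCols (z • E - A) B).mulVec := by
  have hrange : LinearMap.range (B.mulVecLin.range.mkQ ∘ₗ A.mulVecLin) ≤
      LinearMap.range (B.mulVecLin.range.mkQ ∘ₗ E.mulVecLin) := by
    rintro _ ⟨x, rfl⟩
    obtain ⟨w, hw⟩ := hEB.surjective (A *ᵥ x)
    rw [fromCols_mulVec] at hw
    exact ⟨w ∘ Sum.inl, (Submodule.Quotient.eq _).2 ⟨-(w ∘ Sum.inr), by simp [← hw, mulVec_neg]⟩⟩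
  obtain ⟨z, x, hx, hzx⟩ :=
    exists_eigenvector_of_range_le (fromCols_mulVec_injective_iff.1 hEB.injective).2 hrange
  refine ⟨z, fun hinj => hx ?_⟩
  refine (injective_iff_map_eq_zero _).1 (fromCols_mulVec_injective_iff.1 hinj).2 x ?_
  simpa [sub_mulVec, smul_mulVec, sub_eq_zero] using hzx.symm

variable {𝕜 : Type*} [RCLike 𝕜] {ℓ n m : ℕ}

theorem genericOnSigma_not_fullRankPointwise (hn : 0 < n) (h : ℓ = n + m) :
    GenericOnSigma fun (E A : Matrix (Fin ℓ) (Fin n) 𝕜) (B : Matrix (Fin ℓ) (Fin m) 𝕜) =>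
      ¬ FullRankPointwise E A B := by
  subst h
  have : Nonempty (Fin n) := ⟨⟨0, hn⟩⟩
  have hsquare (M : Matrix (Fin (n + m)) (Fin n ⊕ Fin m) ℂ) :
      HasFullRank M ↔ Function.Injective M.mulVec := by
    simp [HasFullRank, mulVec_injective_iff_rank_eq_card]
  refine .of_hasFullRank
    (N := fun E _ B => fromCols (E.map (RCLike.map 𝕜 ℂ)) (B.map (RCLike.map 𝕜 ℂ)))
    (isLinearMap_fromCols (isLinearMap_map ⟨fun _ _ => rfl, fun _ _ => rfl⟩)
      (isLinearMap_map ⟨fun _ _ => rfl, fun _ _ => rfl⟩)) (fun E A B hEB hP => ?_) (J₁ := 0)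
    (E₁ := unitCols 𝕜 _ fun c : Fin n => (c : ℕ)) (B₁ := unitCols 𝕜 _ fun c : Fin m => n + c)
    (by simp) ?_
  · have hinj := (hsquare _).1 hEB
    have hsurj := (LinearMap.injective_iff_surjective_of_finrank_eq_finrank
      (f := (fromCols (E.map (RCLike.map 𝕜 ℂ)) (B.map (RCLike.map 𝕜 ℂ))).mulVecLin) (by simp)).1
      hinj
    obtain ⟨z, hz⟩ := exists_pencil_mulVec_not_injective (A := A.map (RCLike.map 𝕜 ℂ))
      ⟨hinj, hsurj⟩
    exact hz ((hsquare _).1 (fullRankPointwise_iff_hasFullRank.1 hP z))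
  · rw [unitCols_map, unitCols_map]
    exact hasFullRank_fromCols_unitCols n m

theorem zero_mem_sigmaH : (0 : Quadruple 𝕜 ℓ n m) ∈ SigmaH 𝕜 ℓ n m :=
  ⟨by simp, by simp, by simpa using PosSemidef.zero⟩

theorem zero_mem_sigmaSdH : (0 : Quintuple 𝕜 ℓ n m) ∈ SigmaSdH 𝕜 ℓ n m :=
  ⟨by simp, ⟨by simp, PosSemidef.zero⟩, by simp, by simpa using PosSemidef.zero⟩

theorem isRelGeneric_compl_si (hn : 0 < n) (h : ℓ = n + m) :
    IsRelGeneric (Si 𝕜 ℓ n m)ᶜ (SigmaH 𝕜 ℓ n m) :=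
  (genericOnSigma_not_fullRankPointwise hn h).1

theorem isRelGeneric_compl_sj (hn : 0 < n) (h : ℓ = n + m) :
    IsRelGeneric (Sj 𝕜 ℓ n m)ᶜ (SigmaSdH 𝕜 ℓ n m) :=
  (genericOnSigma_not_fullRankPointwise hn h).2 _ (.inl rfl)

end Square

end PortHamiltonian

end

theorem mainTheorem3 (𝕜 : Type*) [RCLike 𝕜] (ℓ n m : ℕ) (hℓ : 0 < ℓ) (hn : 0 < n) (hm : 0 < m) :
    (PortHamiltonian.IsRelGeneric (PortHamiltonian.Sa 𝕜 ℓ n m) (PortHamiltonian.SigmaH 𝕜 ℓ n m) ∧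
     PortHamiltonian.IsRelGeneric (PortHamiltonian.Sb 𝕜 ℓ n m) (PortHamiltonian.SigmaH 𝕜 ℓ n m) ∧
     PortHamiltonian.IsRelGeneric (PortHamiltonian.Sc 𝕜 ℓ n m) (PortHamiltonian.SigmaH 𝕜 ℓ n m) ∧
     PortHamiltonian.IsRelGeneric (PortHamiltonian.Sd 𝕜 ℓ n m) (PortHamiltonian.SigmaH 𝕜 ℓ n m)) ∧
    (∀ V ∈ ({PortHamiltonian.SigmaSdH 𝕜 ℓ n m, PortHamiltonian.SigmaDH 𝕜 ℓ n m} :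
        Set (Set (PortHamiltonian.Quintuple 𝕜 ℓ n m))),
      PortHamiltonian.IsRelGeneric (PortHamiltonian.Se 𝕜 ℓ n m) V ∧
      PortHamiltonian.IsRelGeneric (PortHamiltonian.Sf 𝕜 ℓ n m) V ∧
      PortHamiltonian.IsRelGeneric (PortHamiltonian.Sg 𝕜 ℓ n m) V ∧
      PortHamiltonian.IsRelGeneric (PortHamiltonian.Sh 𝕜 ℓ n m) V) ∧
    ((PortHamiltonian.IsRelGeneric (PortHamiltonian.Si 𝕜 ℓ n m)
        (PortHamiltonian.SigmaH 𝕜 ℓ n m) ↔ ℓ ≠ n + m) ∧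
     (ℓ = n + m → PortHamiltonian.IsRelGeneric (PortHamiltonian.Si 𝕜 ℓ n m)ᶜ
        (PortHamiltonian.SigmaH 𝕜 ℓ n m))) ∧
    ((PortHamiltonian.IsRelGeneric (PortHamiltonian.Sj 𝕜 ℓ n m)
        (PortHamiltonian.SigmaSdH 𝕜 ℓ n m) ↔ ℓ ≠ n + m) ∧
     (ℓ = n + m → PortHamiltonian.IsRelGeneric (PortHamiltonian.Sj 𝕜 ℓ n m)ᶜ
        (PortHamiltonian.SigmaSdH 𝕜 ℓ n m))) := by
  refine ⟨⟨?_, ?_, ?_, ?_⟩, fun V hV => ⟨?_, ?_, ?_, ?_⟩,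
    ⟨⟨fun hS h => ?_, fun h => ?_⟩, PortHamiltonian.isRelGeneric_compl_si hn⟩,
    ⟨fun hS h => ?_, fun h => ?_⟩, PortHamiltonian.isRelGeneric_compl_sj hn⟩
  · exact PortHamiltonian.genericOnSigma_fullRankEB.1
  · exact PortHamiltonian.genericOnSigma_fullRankEAB.1
  · exact PortHamiltonian.genericOnSigma_fullRankPencil.1
  · exact PortHamiltonian.genericOnSigma_fullRankKernel.1
  · exact PortHamiltonian.genericOnSigma_fullRankEB.2 V hV
  · exact PortHamiltonian.genericOnSigma_fullRankEAB.2 V hV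
  · exact PortHamiltonian.genericOnSigma_fullRankPencil.2 V hV
  · exact PortHamiltonian.genericOnSigma_fullRankKernel.2 V hV
  · exact hS.not_compl ⟨0, PortHamiltonian.zero_mem_sigmaH⟩
      (PortHamiltonian.isRelGeneric_compl_si hn h)
  · exact (PortHamiltonian.genericOnSigma_fullRankPointwise hm h).1
  · exact hS.not_compl ⟨0, PortHamiltonian.zero_mem_sigmaSdH⟩
      (PortHamiltonian.isRelGeneric_compl_sj hn h)
  · exact (PortHamiltonian.genericOnSigma_fullRankPointwise hm h).2 _ (.inl rfl)
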